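/- Let $n$ be a natural number and $q\in(0,1)$. Let $\mathrm{Pol}(\mathrm{Mat}_n)_q$ be the unital complex $*$-algebra with generators $z_a^\alpha,(z_a^\alpha)^*$ ($1\le a,\alpha\le n$) and relations $$z_a^\alpha z_b^\beta=q z_b^\beta z_a^\alpha\quad(a=b,\ \alpha<\beta\ \text{ or }\ a<b,\ \alpha=\beta),\qquad z_a^\alpha z_b^\beta=z_b^\beta z_a^\alpha\quad(\alpha<\beta,\ a>b),$$ $$z_a^\alpha z_b^\beta-z_b^\beta z_a^\alpha=(q-q^{-1})z_a^\beta z_b^\alpha\quad(\alpha<\beta,\ a<b),$$ the adjoints of these relations, and, for all $a,b,\alpha,\beta$, $$(z_b^\beta)^*z_a^\alpha=q^2\sum_{a',b',\alpha',\beta'=1}^n R_{ba}^{b'a'}R_{\beta\alpha}^{\beta'\alpha'}\,z_{a'}^{\alpha'}(z_{b'}^{\beta'})^*+(1-q^2)\delta_{ab}\delta^{\alpha\beta},$$ where $R_{ij}^{kl}=q^{-1}$ if $i\ne j,\ i=k,\ j=l$; $R_{ij}^{kl}=1$ if $i=j=k=l$; $R_{ij}^{kl}=-(q^{-2}-1)$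 if $i=j,\ k=l,\ l>j$; and $R_{ij}^{kl}=0$ otherwise. A Fock representation is a bounded $*$-representation $\pi_{F,n}$ of $\mathrm{Pol}(\mathrm{Mat}_n)_q$ on the Hilbert space $H_{F,n}$ that is the (separated) completion of the $\mathrm{Pol}(\mathrm{Mat}_n)_q$-module with one generator $v_0$ and defining relations $(z_j^i)^*v_0=0$, with respect to a positive sesquilinear form with $(v_0,v_0)=1$ and $(fu,v)=(u,f^*v)$ for all $f\in\mathrm{Pol}(\mathrm{Mat}_n)_q$. Let $C_F(\overline{\mathbb D}_n)_q\subset B(H_{F,n})$ be the unital $C^*$-algebra generated by the operators $\pi_{F,n}(z_j^i)$, $1\le i,j\le n$. On $\ell^2(\mathbb Z_+)$ let $Se_k=e_{k+1}$, $C_qe_k=\sqrt{1-q^{2k}}\,e_k$, $d(q)e_k=q^ke_k$, and for $1\le s\le 2n-1$, $1\le a,b\le 2n$ put $$\pi_s(t_{s,s})=S^*C_q,\quad \pi_s(t_{s,s+1})=q\,d(q),\quad \pi_s(t_{s+1,s})=-d(q),\quad \pi_s(t_{s+1,s+1})=C_qS,$$ and $\pi_s(t_{a,b})=\delta_{ab}I$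 in all other cases. Let $(\sigma_1,\dots,\sigma_{n^2})$ be the concatenation of the words $(k+n-1,k+n-2,\dots,k)$ for $k=1,\dots,n$, and define operators on $\ell^2(\mathbb Z_+)^{\otimes n^2}$ by $$\mathcal T_j^i=q^{i-n}\sum_{k_1,\dots,k_{n^2-1}=1}^{2n}\pi_{\sigma_1}(t_{n+i,k_1})\otimes\pi_{\sigma_2}(t_{k_1,k_2})\otimes\cdots\otimes\pi_{\sigma_{n^2}}(t_{k_{n^2-1},n+j}),\qquad 1\le i,j\le n.$$ Let $C^*(S)\subset B(\ell^2(\mathbb Z_+))$ be the Toeplitz algebra, i.e. the $C^*$-algebra generated by the unilateral shift $S$, and let $C^*(S)^{\otimes n^2}\subset B(\ell^2(\mathbb Z_+)^{\otimes n^2})$ be the spatial tensor product of $n^2$ copies, i.e. the $C^*$-algebra generated by the elementary tensors $A_1\otimes\cdots\otimes A_{n^2}$ with all $A_m\in C^*(S)$. Then there is a Fock representation on $\ell^2(\mathbb Z_+)^{\otimes n^2}$ which sends $z_j^i$ to $\mathcal T_j^i$ for all $i,j$. Moreover, for every Fock representation $\pi_{F,n}$ on a Hilbert space $H_{F,n}$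 there is a unitary $U:H_{F,n}\to\ell^2(\mathbb Z_+)^{\otimes n^2}$ such that $$U\pi_{F,n}(z_j^i)U^*=\mathcal T_j^i\quad(1\le i,j\le n)\qquad\text{and}\qquad U\,C_F(\overline{\mathbb D}_n)_q\,U^*\subset C^*(S)^{\otimes n^2}.$$ -/

import Mathlib

open scoped lp

noncomputable section

namespace QMatBall

set_option linter.unusedSectionVars false

/-! ### Bounded operators on `ℓ²` spaces -/

/-- The Hilbert space `ℓ²(α)` of square summable complex families indexed by `α`. -/
abbrev L2 (α : Type*) : Type _ := ℓ²(α, ℂ)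

theorem memL2_iff {α : Type*} (f : α → ℂ) :
    Memℓp (E := fun _ : α => ℂ) f 2 ↔ ∑' a, ‖f a‖ₑ ^ 2 ≠ ⊤ := by
  rw [memℓp_gen_iff (by norm_num)]
  have h : ∀ a, ‖f a‖ ^ (2 : ENNReal).toReal = ((‖f a‖₊ ^ 2 : NNReal) : ℝ) := by
    intro a; simp
  have h2 : ∀ a, ‖f a‖ₑ ^ 2 = ((‖f a‖₊ ^ 2 : NNReal) : ENNReal) := by
    intro a; simp [enorm]
  simp only [h, h2]
  rw [NNReal.summable_coe, ENNReal.tsum_coe_ne_top_iff_summable]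

theorem enorm_sq_L2 {α : Type*} (x : L2 α) : ‖x‖ₑ ^ 2 = ∑' a, ‖x a‖ₑ ^ 2 := by
  have h := lp.norm_rpow_eq_tsum (p := 2) (by norm_num) x
  have hs : Summable fun a => ‖x a‖₊ ^ 2 := by
    have := (memL2_iff (x : α → ℂ)).1 (lp.memℓp x)
    rw [← ENNReal.tsum_coe_ne_top_iff_summable]
    simpa [enorm] using this
  have h' : ‖x‖₊ ^ 2 = ∑' a, ‖x a‖₊ ^ 2 := by
    apply NNReal.coe_injective
    rw [NNReal.coe_tsum]
    simpa using h
  have h2 : ∀ a, ‖x a‖ₑ ^ 2 = ((‖x a‖₊ ^ 2 : NNReal) : ENNReal) := by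
    intro a; simp [enorm]
  simp only [h2]
  rw [← ENNReal.coe_tsum hs, ← h']
  simp [enorm]

/-- A bounded operator between `ℓ²` spaces given by the coordinates of its values. -/
def mkOp {α β : Type*} (T : L2 α → β → ℂ) (C : NNReal)
    (hadd : ∀ x y b, T (x + y) b = T x b + T y b) (hsmul : ∀ (c : ℂ) x b, T (c • x) b = c * T x b)
    (hT : ∀ x, ∑' b, ‖T x b‖ₑ ^ 2 ≤ (C : ENNReal) ^ 2 * ∑' a, ‖x a‖ₑ ^ 2) : L2 α →L[ℂ] L2 β :=
  LinearMap.mkContinuous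
    { toFun := fun x => ⟨T x, (memL2_iff (T x)).2 (ne_top_of_le_ne_top
          (ENNReal.mul_ne_top (by simp) ((memL2_iff (x : α → ℂ)).1 (lp.memℓp x))) (hT x))⟩
      map_add' := fun x y => by ext b; exact hadd x y b
      map_smul' := fun c x => by ext b; exact hsmul c x b }
    C (by
      intro x
      set y : L2 β := ⟨T x, (memL2_iff (T x)).2 (ne_top_of_le_ne_top
          (ENNReal.mul_ne_top (by simp) ((memL2_iff (x : α → ℂ)).1 (lp.memℓp x))) (hT x))⟩
      change ‖y‖ ≤ C * ‖x‖
      have h : ‖y‖ₑ ^ 2 ≤ ((C : ENNReal) * ‖x‖ₑ) ^ 2 := by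
        rw [mul_pow, enorm_sq_L2 x, enorm_sq_L2 y]; exact hT x
      have h1 : ‖y‖ₑ ≤ (C : ENNReal) * ‖x‖ₑ := by
        by_contra hc
        exact absurd h (not_le.2 (ENNReal.pow_lt_pow_left (by norm_num) (not_le.1 hc)))
      have h2 : ‖y‖₊ ≤ C * ‖x‖₊ := by
        rw [← ENNReal.coe_le_coe]; simpa [enorm] using h1
      exact_mod_cast h2)

@[simp] theorem mkOp_apply {α β : Type*} (T : L2 α → β → ℂ) (C : NNReal)
    (hadd : ∀ x y b, T (x + y) b = T x b + T y b) (hsmul : ∀ (c : ℂ) x b, T (c • x) b = c * T x b)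
    (hT : ∀ x, ∑' b, ‖T x b‖ₑ ^ 2 ≤ (C : ENNReal) ^ 2 * ∑' a, ‖x a‖ₑ ^ 2) (x : L2 α) (b : β) :
    mkOp T C hadd hsmul hT x b = T x b := rfl

/-- The unilateral shift `S e_k = e_{k+1}` on `ℓ²(ℕ)`. -/
def shift : L2 ℕ →L[ℂ] L2 ℕ :=
  mkOp (fun x k => Nat.casesOn k 0 (fun m => x m)) 1
    (by rintro x y (_ | b) <;> simp) (by rintro c x (_ | b) <;> simp)
    (by
      intro x
      rw [tsum_eq_zero_add' ENNReal.summable]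
      simp)

/-- The diagonal operator `e_k ↦ a k • e_k` on `ℓ²(ℕ)`, for a sequence bounded by `1`. -/
def diag (a : ℕ → ℂ) (ha : ∀ k, ‖a k‖ ≤ 1) : L2 ℕ →L[ℂ] L2 ℕ :=
  mkOp (fun x k => a k * x k) 1
    (by intro x y b; simp [mul_add]) (by intro c x b; simp; ring)
    (by
      intro x
      rw [ENNReal.coe_one, one_pow, one_mul]
      refine ENNReal.tsum_le_tsum fun k => pow_le_pow_left₀ (zero_le) ?_ 2
      rw [enorm_mul]
      refine mul_le_of_le_one_left (zero_le) ?_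
      have : ‖a k‖₊ ≤ 1 := ha k
      simpa [enorm] using this)

/-! ### Hilbert space tensor powers

The Hilbert space `ℓ²(ℕ)^{⊗ N}` is `ℓ²(Fin N → ℕ)`, the basis vector `e_{f 0} ⊗ ⋯ ⊗ e_{f (N-1)}`
being the standard basis vector indexed by `f`. -/

/-- The family `k ↦ x (g with its i-th entry replaced by k)`, as a vector of `ℓ²(ℕ)`. -/
def slice {ι : Type*} [DecidableEq ι] (i : ι) (g : ι → ℕ) (x : L2 (ι → ℕ)) : L2 ℕ :=
  ⟨fun k => x (Function.update g i k), (memL2_iff _).2 (ne_top_of_le_ne_top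
    ((memL2_iff (x : (ι → ℕ) → ℂ)).1 (lp.memℓp x))
    (ENNReal.tsum_comp_le_tsum_of_injective (Function.update_injective g i)
      (fun f => ‖x f‖ₑ ^ 2)))⟩

theorem slice_apply {ι : Type*} [DecidableEq ι] (i : ι) (g : ι → ℕ) (x : L2 (ι → ℕ)) (k : ℕ) :
    slice i g x k = x (Function.update g i k) := rfl

/-- The operator `1 ⊗ ⋯ ⊗ 1 ⊗ A ⊗ 1 ⊗ ⋯ ⊗ 1`, with `A` acting on the `i`-th tensor factor. -/
def site {ι : Type*} [DecidableEq ι] (i : ι) (A : L2 ℕ →L[ℂ] L2 ℕ) :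
    L2 (ι → ℕ) →L[ℂ] L2 (ι → ℕ) :=
  mkOp (fun x g => A (slice i g x) (g i)) ‖A‖₊
    (by
      intro x y g
      have : slice i g (x + y) = slice i g x + slice i g y := rfl
      simp [this])
    (by
      intro c x g
      have : slice i g (c • x) = c • slice i g x := rfl
      simp [this])
    (by
      intro x
      have key : ∀ F : (ι → ℕ) → ENNReal, ∑' g, F g =
          ∑' (h : {j // j ≠ i} → ℕ) (k : ℕ), F ((Equiv.funSplitAt i ℕ).symm (k, h)) := by
        intro F
        rw [← (Equiv.funSplitAt i ℕ).symm.tsum_eq F, ENNReal.tsum_prod', ENNReal.tsum_comm]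
      rw [key, key, ← ENNReal.tsum_mul_left]
      refine ENNReal.tsum_le_tsum fun h => ?_
      have hk : ∀ k l, Function.update ((Equiv.funSplitAt i ℕ).symm (k, h)) i l
          = (Equiv.funSplitAt i ℕ).symm (l, h) := by
        intro k l
        ext j
        by_cases hj : j = i
        · subst hj; simp [Equiv.funSplitAt, Equiv.piSplitAt]
        · simp [Equiv.funSplitAt, Equiv.piSplitAt, hj]
      have hs : ∀ k, slice i ((Equiv.funSplitAt i ℕ).symm (k, h)) x
          = slice i ((Equiv.funSplitAt i ℕ).symm (0, h)) x := by
        intro k; ext l; simp only [slice_apply, hk]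
      have hi : ∀ k, (Equiv.funSplitAt i ℕ).symm (k, h) i = k := by
        intro k; simp [Equiv.funSplitAt, Equiv.piSplitAt]
      simp only [hs, hi]
      have e1 := enorm_sq_L2 (slice i ((Equiv.funSplitAt i ℕ).symm (0, h)) x)
      simp only [slice_apply, hk] at e1
      rw [← e1, ← enorm_sq_L2, ← mul_pow]
      exact pow_le_pow_left₀ (zero_le) (ContinuousLinearMap.le_opENorm A _) 2)

theorem site_apply {ι : Type*} [DecidableEq ι] (i : ι) (A : L2 ℕ →L[ℂ] L2 ℕ) (x : L2 (ι → ℕ))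
    (g : ι → ℕ) : site i A x g = A (slice i g x) (g i) := rfl

/-- The elementary tensor `A 0 ⊗ A 1 ⊗ ⋯ ⊗ A (N-1)` as an operator on `ℓ²(ℕ)^{⊗ N}`. -/
def tensorOp {N : ℕ} (A : Fin N → (L2 ℕ →L[ℂ] L2 ℕ)) :
    L2 (Fin N → ℕ) →L[ℂ] L2 (Fin N → ℕ) :=
  ((List.finRange N).map fun m => site m (A m)).prod

theorem list_site_single {N : ℕ} (A : Fin N → (L2 ℕ →L[ℂ] L2 ℕ)) (f : Fin N → ℕ)
    (l : List (Fin N)) (hl : l.Nodup) (g : Fin N → ℕ) :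
    (l.map fun m => site m (A m)).prod (lp.single 2 f (1 : ℂ)) g
      = if ∀ m, m ∉ l → g m = f m then
          (l.map fun m => A m (lp.single 2 (f m) (1 : ℂ)) (g m)).prod else 0 := by
  induction l generalizing g with
  | nil =>
    have h : (∀ m, g m = f m) ↔ g = f := funext_iff.symm
    by_cases hg : g = f
    · subst hg; simp
    · simp [h, hg, lp.single_apply]
  | cons i l ih =>
    have hil : i ∉ l := (List.nodup_cons.1 hl).1
    have hl' := (List.nodup_cons.1 hl).2
    rw [List.map_cons, List.prod_cons, show ∀ (B D : L2 (Fin N → ℕ) →L[ℂ] L2 (Fin N → ℕ)) v, (B * D) v = B (D v) from fun _ _ _ => rfl,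
      site_apply]
    set y := (l.map fun m => site m (A m)).prod (lp.single 2 f (1 : ℂ)) with hy
    have hprod : ∀ k, (l.map fun m => A m (lp.single 2 (f m) (1 : ℂ))
        (Function.update g i k m)).prod =
        (l.map fun m => A m (lp.single 2 (f m) (1 : ℂ)) (g m)).prod := by
      intro k
      congr 1
      refine List.map_congr_left fun m hm => ?_
      have : m ≠ i := fun h => hil (h ▸ hm)
      rw [Function.update_of_ne this]
    have hs : slice i g y = (if ∀ m, m ∉ i :: l → g m = f m then
        (l.map fun m => A m (lp.single 2 (f m) (1 : ℂ)) (g m)).prod else 0)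
          • lp.single 2 (f i) (1 : ℂ) := by
      ext k
      have hc : (∀ m, m ∉ l → Function.update g i k m = f m) ↔
          k = f i ∧ ∀ m, m ∉ i :: l → g m = f m := by
        constructor
        · intro h
          refine ⟨by simpa using h i hil, fun m hm => ?_⟩
          have hm' : m ≠ i ∧ m ∉ l := by simpa using hm
          simpa [Function.update_of_ne hm'.1] using h m hm'.2
        · rintro ⟨h1, h2⟩ m hm
          by_cases hmi : m = i
          · subst hmi; simpa using h1
          · rw [Function.update_of_ne hmi]; exact h2 m (by simp [hmi, hm])
      rw [slice_apply, hy, ih hl', hprod]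
      by_cases hk : k = f i
      · subst hk
        simp only [hc, true_and, lp.coeFn_smul, Pi.smul_apply, lp.single_apply_self, smul_eq_mul,
          mul_one]
      · simp only [hc, hk, false_and, if_false, lp.coeFn_smul, Pi.smul_apply, smul_eq_mul]
        rw [lp.single_apply_ne _ _ _ hk, mul_zero]
    rw [hs, map_smul, lp.coeFn_smul, Pi.smul_apply, List.map_cons, List.prod_cons]
    split_ifs <;> simp [mul_comm]

/-- The matrix coefficients of an elementary tensor are the products of the matrix coefficients
of its factors. -/
theorem tensorOp_single_apply {N : ℕ} (A : Fin N → (L2 ℕ →L[ℂ] L2 ℕ)) (f g : Fin N → ℕ) :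
    tensorOp A (lp.single 2 f (1 : ℂ)) g = ∏ m, A m (lp.single 2 (f m) (1 : ℂ)) (g m) := by
  rw [tensorOp, list_site_single A f _ (List.nodup_finRange N) g]
  simp [List.prod_ofFn, ← List.ofFn_eq_map]

/-! ### The Toeplitz algebra and its spatial tensor powers -/

/-- `C*(S)`, the (unital) C*-algebra generated by the unilateral shift. -/
def toeplitz : StarSubalgebra ℂ (L2 ℕ →L[ℂ] L2 ℕ) :=
  (StarAlgebra.adjoin ℂ {shift}).topologicalClosure

/-- `C*(S)^{⊗ N}`, the spatial tensor product of `N` copies of `C*(S)`: the C*-algebra of operators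
on `ℓ²(ℕ)^{⊗ N}` generated by the elementary tensors whose factors lie in `C*(S)`. -/
def toeplitzTensor (N : ℕ) : StarSubalgebra ℂ (L2 (Fin N → ℕ) →L[ℂ] L2 (Fin N → ℕ)) :=
  (StarAlgebra.adjoin ℂ
    {T | ∃ A : Fin N → (L2 ℕ →L[ℂ] L2 ℕ), (∀ m, A m ∈ toeplitz) ∧ T = tensorOp A}).topologicalClosure

/-! ### The `*`-algebra `Pol(Mat_n)_q` -/

/-- The coefficients `R_{ij}^{kl}`. -/
def Rcoef {n : ℕ} (q : ℝ) (i j k l : Fin n) : ℂ :=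
  if i ≠ j ∧ i = k ∧ j = l then (q : ℂ)⁻¹
  else if i = j ∧ j = k ∧ k = l then 1
  else if i = j ∧ k = l ∧ j < l then -(((q : ℂ) ^ 2)⁻¹ - 1)
  else 0

/-- The free algebra on the symbols `z_a^α` and `(z_a^α)^*`. -/
abbrev Free (n : ℕ) : Type := FreeAlgebra ℂ ((Fin n × Fin n) ⊕ (Fin n × Fin n))

/-- The free generator `z_a^α` (upper index `α`, lower index `a`). -/
def fz {n : ℕ} (α a : Fin n) : Free n := FreeAlgebra.ι ℂ (Sum.inl (α, a))

/-- The free generator `(z_a^α)^*` (upper index `α`, lower index `a`). -/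
def fzs {n : ℕ} (α a : Fin n) : Free n := FreeAlgebra.ι ℂ (Sum.inr (α, a))

/-- The defining relations of `Pol(Mat_n)_q`. -/
inductive PolRel (n : ℕ) (q : ℝ) : Free n → Free n → Prop
  | zz_q (α β a b : Fin n) (h : (a = b ∧ α < β) ∨ (a < b ∧ α = β)) :
      PolRel n q (fz α a * fz β b) ((q : ℂ) • (fz β b * fz α a))
  | zz_comm (α β a b : Fin n) (h : α < β ∧ b < a) :
      PolRel n q (fz α a * fz β b) (fz β b * fz α a)
  | zz_cross (α β a b : Fin n) (h : α < β ∧ a < b) :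
      PolRel n q (fz α a * fz β b)
        (fz β b * fz α a + ((q : ℂ) - (q : ℂ)⁻¹) • (fz β a * fz α b))
  | ss_q (α β a b : Fin n) (h : (a = b ∧ α < β) ∨ (a < b ∧ α = β)) :
      PolRel n q (fzs β b * fzs α a) ((q : ℂ) • (fzs α a * fzs β b))
  | ss_comm (α β a b : Fin n) (h : α < β ∧ b < a) :
      PolRel n q (fzs β b * fzs α a) (fzs α a * fzs β b)
  | ss_cross (α β a b : Fin n) (h : α < β ∧ a < b) :
      PolRel n q (fzs β b * fzs α a)
        (fzs α a * fzs β b + ((q : ℂ) - (q : ℂ)⁻¹) • (fzs α b * fzs β a))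
  | sz (α β a b : Fin n) :
      PolRel n q (fzs β b * fz α a)
        ((q : ℂ) ^ 2 • (∑ a' : Fin n, ∑ b' : Fin n, ∑ α' : Fin n, ∑ β' : Fin n,
            (Rcoef q b a b' a' * Rcoef q β α β' α') • (fz α' a' * fzs β' b'))
          + if a = b ∧ α = β then algebraMap ℂ (Free n) (1 - (q : ℂ) ^ 2) else 0)

/-- The algebra `Pol(Mat_n)_q`. -/
def Pol (n : ℕ) (q : ℝ) : Type := RingQuot (PolRel n q)

instance (n : ℕ) (q : ℝ) : Ring (Pol n q) := inferInstanceAs (Ring (RingQuot (PolRel n q)))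

instance (n : ℕ) (q : ℝ) : Algebra ℂ (Pol n q) :=
  inferInstanceAs (Algebra ℂ (RingQuot (PolRel n q)))

/-- The quotient map onto `Pol(Mat_n)_q`. -/
def Pol.mk (n : ℕ) (q : ℝ) : Free n →ₐ[ℂ] Pol n q := RingQuot.mkAlgHom ℂ (PolRel n q)

/-- The generator `z_a^α` of `Pol(Mat_n)_q` (upper index `α`, lower index `a`). -/
def Pol.z {n : ℕ} {q : ℝ} (α a : Fin n) : Pol n q := Pol.mk n q (fz α a)

/-- The generator `(z_a^α)^*` of `Pol(Mat_n)_q` (upper index `α`, lower index `a`). -/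
def Pol.zs {n : ℕ} {q : ℝ} (α a : Fin n) : Pol n q := Pol.mk n q (fzs α a)

theorem Pol.rel {n : ℕ} {q : ℝ} {x y : Free n} (h : PolRel n q x y) :
    Pol.mk n q x = Pol.mk n q y := RingQuot.mkAlgHom_rel ℂ h

theorem Pol.mk_surjective (n : ℕ) (q : ℝ) : Function.Surjective (Pol.mk n q) :=
  RingQuot.mkAlgHom_surjective ℂ _

/-- The opposite algebra, with complex scalars acting through complex conjugation. -/
def ConjOp (A : Type) : Type := Aᵐᵒᵖ

instance (A : Type) [Ring A] : Ring (ConjOp A) := inferInstanceAs (Ring Aᵐᵒᵖ)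

instance (A : Type) [Ring A] [Algebra ℂ A] : Algebra ℂ (ConjOp A) :=
  RingHom.toAlgebra' (R := ℂ) (S := Aᵐᵒᵖ) ((algebraMap ℂ Aᵐᵒᵖ).comp (starRingEnd ℂ))
    (fun c x => Algebra.commutes (A := Aᵐᵒᵖ) ((starRingEnd ℂ) c) x)

/-- The identity map from `A` to `ConjOp A`. -/
def toConj {A : Type} (x : A) : ConjOp A := MulOpposite.op x

/-- The identity map from `ConjOp A` to `A`. -/
def ofConj {A : Type} (x : ConjOp A) : A := MulOpposite.unop (α := A) x

section
variable {A : Type} [Ring A] [Algebra ℂ A]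

@[simp] theorem ofConj_toConj (x : A) : ofConj (toConj x) = x := rfl
@[simp] theorem ofConj_add (x y : ConjOp A) : ofConj (x + y) = ofConj x + ofConj y := rfl
@[simp] theorem ofConj_zero : ofConj (0 : ConjOp A) = 0 := rfl
@[simp] theorem ofConj_mul (x y : ConjOp A) : ofConj (x * y) = ofConj y * ofConj x := rfl
@[simp] theorem ofConj_algebraMap (c : ℂ) :
    ofConj (algebraMap ℂ (ConjOp A) c) = algebraMap ℂ A (starRingEnd ℂ c) := rfl
@[simp] theorem ofConj_smul (c : ℂ) (x : ConjOp A) :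
    ofConj (c • x) = starRingEnd ℂ c • ofConj x := by
  rw [Algebra.smul_def, ofConj_mul, ofConj_algebraMap, ← Algebra.commutes, Algebra.smul_def]
@[simp] theorem ofConj_sum {ι : Type*} (s : Finset ι) (f : ι → ConjOp A) :
    ofConj (∑ i ∈ s, f i) = ∑ i ∈ s, ofConj (f i) := by
  classical
  induction s using Finset.induction_on with
  | empty => simp
  | insert a s ha ih => simp [Finset.sum_insert ha, ih]

theorem ofConj_injective : Function.Injective (ofConj : ConjOp A → A) :=
  MulOpposite.unop_injective

end

theorem conj_Rcoef {n : ℕ} (q : ℝ) (i j k l : Fin n) :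
    starRingEnd ℂ (Rcoef q i j k l) = Rcoef q i j k l := by
  unfold Rcoef
  split_ifs <;> simp

theorem Rcoef_symm {n : ℕ} (q : ℝ) (i j k l : Fin n) : Rcoef q i j k l = Rcoef q j i l k := by
  unfold Rcoef
  have h1 : (i ≠ j ∧ i = k ∧ j = l) ↔ (j ≠ i ∧ j = l ∧ i = k) := by
    constructor <;> rintro ⟨a, b, c⟩ <;> exact ⟨a.symm, c, b⟩
  have h2 : (i = j ∧ j = k ∧ k = l) ↔ (j = i ∧ i = l ∧ l = k) := by
    constructor <;> rintro ⟨a, b, c⟩ <;> subst a b c <;> simp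
  have h3 : (i = j ∧ k = l ∧ j < l) ↔ (j = i ∧ l = k ∧ i < k) := by
    constructor <;> rintro ⟨a, b, c⟩ <;> subst a b <;> simpa using c
  simp only [h1, h2, h3]

/-- The conjugate linear anti-homomorphism with `z_a^α ↦ (z_a^α)^*` and `(z_a^α)^* ↦ z_a^α`,
on the free algebra. -/
def freeStar (n : ℕ) (q : ℝ) : Free n →ₐ[ℂ] ConjOp (Pol n q) :=
  FreeAlgebra.lift ℂ (Sum.elim (fun p => toConj (Pol.zs p.1 p.2)) (fun p => toConj (Pol.z p.1 p.2)))

@[simp] theorem freeStar_fz {n : ℕ} {q : ℝ} (α a : Fin n) :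
    freeStar n q (fz α a) = toConj (Pol.zs α a) := by simp [freeStar, fz]

@[simp] theorem freeStar_fzs {n : ℕ} {q : ℝ} (α a : Fin n) :
    freeStar n q (fzs α a) = toConj (Pol.z α a) := by simp [freeStar, fzs]

theorem freeStar_rel {n : ℕ} {q : ℝ} ⦃x y : Free n⦄ (h : PolRel n q x y) :
    freeStar n q x = freeStar n q y := by
  apply ofConj_injective
  induction h with
  | zz_q α β a b h => simpa [Pol.zs, -Complex.coe_smul] using Pol.rel (PolRel.ss_q (q := q) α β a b h)
  | zz_comm α β a b h => simpa [Pol.zs, -Complex.coe_smul] using Pol.rel (PolRel.ss_comm (q := q) α β a b h)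
  | zz_cross α β a b h => simpa [Pol.zs, -Complex.coe_smul] using Pol.rel (PolRel.ss_cross (q := q) α β a b h)
  | ss_q α β a b h => simpa [Pol.z, -Complex.coe_smul] using Pol.rel (PolRel.zz_q (q := q) α β a b h)
  | ss_comm α β a b h => simpa [Pol.z, -Complex.coe_smul] using Pol.rel (PolRel.zz_comm (q := q) α β a b h)
  | ss_cross α β a b h => simpa [Pol.z, -Complex.coe_smul] using Pol.rel (PolRel.zz_cross (q := q) α β a b h)
  | sz α β a b =>
    have h := Pol.rel (PolRel.sz (q := q) β α b a)
    have hc : (b = a ∧ β = α) ↔ (a = b ∧ α = β) := by constructor <;> rintro ⟨a, b⟩ <;> simp [a, b]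
    simp only [map_mul, map_add, map_smul, map_sum, ofConj_mul, ofConj_add, ofConj_smul,
      ofConj_sum, freeStar_fz, freeStar_fzs, ofConj_toConj, hc, conj_Rcoef] at h ⊢
    rw [show (Pol.zs α a * Pol.z β b : Pol n q) =
      Pol.mk n q (fzs α a) * Pol.mk n q (fz β b) from rfl, h]
    congr 1
    · congr 1
      · simp
      · rw [Finset.sum_comm]
        refine Finset.sum_congr rfl fun a' _ => Finset.sum_congr rfl fun b' _ => ?_
        rw [Finset.sum_comm]
        refine Finset.sum_congr rfl fun α' _ => Finset.sum_congr rfl fun β' _ => ?_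
        rw [Rcoef_symm q a b, Rcoef_symm q α β]
        rfl
    · split_ifs
      · simp only [AlgHom.commutes, ofConj_algebraMap]
        simp
      · simp

/-- The involution of `Pol(Mat_n)_q`, as a homomorphism to the conjugate opposite algebra. -/
def starHom (n : ℕ) (q : ℝ) : Pol n q →ₐ[ℂ] ConjOp (Pol n q) :=
  RingQuot.liftAlgHom ℂ ⟨freeStar n q, freeStar_rel⟩

theorem starHom_mk {n : ℕ} {q : ℝ} (x : Free n) :
    starHom n q (Pol.mk n q x) = freeStar n q x :=
  RingQuot.liftAlgHom_mkAlgHom_apply ℂ (freeStar n q) freeStar_rel x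

/-- The involution of `Pol(Mat_n)_q`, determined by `* : z_a^α ↦ (z_a^α)^*`. -/
instance (n : ℕ) (q : ℝ) : StarRing (Pol n q) where
  star x := ofConj (starHom n q x)
  star_involutive := by
    intro x
    obtain ⟨x, rfl⟩ := Pol.mk_surjective n q x
    induction x using FreeAlgebra.induction with
    | grade0 r => simp [AlgHom.commutes]
    | grade1 x =>
      rcases x with ⟨α, a⟩ | ⟨α, a⟩
      · have h : FreeAlgebra.ι ℂ (Sum.inl (α, a)) = fz α a := rfl
        simp only [h, starHom_mk, freeStar_fz, freeStar_fzs, ofConj_toConj, Pol.zs, Pol.z]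
      · have h : FreeAlgebra.ι ℂ (Sum.inr (α, a)) = fzs α a := rfl
        simp only [h, starHom_mk, freeStar_fz, freeStar_fzs, ofConj_toConj, Pol.zs, Pol.z]
    | mul a b ha hb => simp only [map_mul, ofConj_mul, ha, hb]
    | add a b ha hb => simp only [map_add, ofConj_add, ha, hb]
  star_mul x y := by simp
  star_add x y := by simp

theorem Pol.star_z {n : ℕ} {q : ℝ} (α a : Fin n) :
    star (Pol.z α a : Pol n q) = Pol.zs α a := by
  change ofConj (starHom n q (Pol.mk n q (fz α a))) = _
  rw [starHom_mk, freeStar_fz]; rfl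

instance (n : ℕ) (q : ℝ) : StarModule ℂ (Pol n q) where
  star_smul c x := by
    change ofConj (starHom n q (c • x)) = _
    rw [map_smul, ofConj_smul]; rfl

/-! ### The Fock representation -/

/-- The left ideal of `Pol(Mat_n)_q` generated by the elements `(z_j^i)^*`. -/
def vacuumIdeal (n : ℕ) (q : ℝ) : Submodule (Pol n q) (Pol n q) :=
  Submodule.span (Pol n q) (Set.range fun p : Fin n × Fin n => star (Pol.z p.1 p.2 : Pol n q))

/-- The `Pol(Mat_n)_q`-module with one generator `v₀` and the defining relations
`(z_j^i)^* v₀ = 0`. -/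
abbrev FockModule (n : ℕ) (q : ℝ) : Type := Pol n q ⧸ vacuumIdeal n q

/-- The generator `v₀` of the Fock module. -/
def vacuum (n : ℕ) (q : ℝ) : FockModule n q := Submodule.Quotient.mk (1 : Pol n q)

/-- A realization of the Fock representation on the Hilbert space `H`: a bounded `*`-representation
on `H`, where `H` is the completion of the Fock module with respect to a form `(u, v)` with
`(v₀, v₀) = 1` for which the action of `f` has the adjoint `f^*`. The form is the one induced from
`H` by `emb`; it satisfies `(f u, v) = (u, f^* v)` since `rep` is a `*`-homomorphism. Its
definiteness (injectivity of `emb`) is not demanded: `H` is the separated completion. -/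
structure FockRep (n : ℕ) (q : ℝ) (H : Type*) [NormedAddCommGroup H] [InnerProductSpace ℂ H]
    [CompleteSpace H] where
  /-- the `*`-representation -/
  rep : Pol n q →⋆ₐ[ℂ] (H →L[ℂ] H)
  /-- the canonical map of the Fock module into its completion -/
  emb : FockModule n q →ₗ[ℂ] H
  emb_smul : ∀ (f : Pol n q) (u : FockModule n q), emb (f • u) = rep f (emb u)
  norm_emb_vacuum : ‖emb (vacuum n q)‖ = 1
  denseRange_emb : DenseRange emb

/-- The C*-algebra `C_F(𝔻̄_n)_q` generated by the operators `π_F(z_j^i)`. -/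
def fockCStar {n : ℕ} {q : ℝ} {H : Type*} [NormedAddCommGroup H] [InnerProductSpace ℂ H]
    [CompleteSpace H] (F : FockRep n q H) : StarSubalgebra ℂ (H →L[ℂ] H) :=
  (StarAlgebra.adjoin ℂ
    (Set.range fun p : Fin n × Fin n => F.rep (Pol.z p.1 p.2))).topologicalClosure

/-! ### The concrete representation on `ℓ²(ℕ)^{⊗ n²}` -/

/-- The diagonal operator `C_q e_k = (1 - q^{2k})^{1/2} e_k` (used for `q ∈ (0, 1)`). -/
def opC (q : ℝ) (h0 : 0 < q) : L2 ℕ →L[ℂ] L2 ℕ :=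
  diag (fun k => (Real.sqrt (1 - q ^ (2 * k)) : ℂ)) (fun k => by
    have : (0 : ℝ) ≤ q ^ (2 * k) := by positivity
    rw [Complex.norm_real, Real.norm_of_nonneg (Real.sqrt_nonneg _)]
    exact Real.sqrt_le_one.2 (by linarith))

/-- The diagonal operator `d(q) e_k = q^k e_k` (for `q ∈ (0, 1)`). -/
def opD (q : ℝ) (h0 : 0 < q) (h1 : q < 1) : L2 ℕ →L[ℂ] L2 ℕ :=
  diag (fun k => ((q ^ k : ℝ) : ℂ)) (fun k => by
    rw [Complex.norm_real, Real.norm_of_nonneg (by positivity)]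
    exact pow_le_one₀ h0.le h1.le)

/-- The operator `π_{s}(t_{a,b})` on `ℓ²(ℕ)`, for the transposition `(s, s+1)`; here `s`, `a`, `b`
count from `1`. -/
def piS (q : ℝ) (h0 : 0 < q) (h1 : q < 1) (s a b : ℕ) : L2 ℕ →L[ℂ] L2 ℕ :=
  if a = s ∧ b = s then star shift * opC q h0
  else if a = s ∧ b = s + 1 then (q : ℂ) • opD q h0 h1
  else if a = s + 1 ∧ b = s then -opD q h0 h1
  else if a = s + 1 ∧ b = s + 1 then opC q h0 * shift
  else if a = b then 1
  else 0

/-- The operator `(π_{σ 0} ⊗ ⋯ ⊗ π_{σ (N-1)})(t_{a,b})`, that is, the sum of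
`π_{σ 0}(t_{k 0, k 1}) ⊗ ⋯ ⊗ π_{σ (N-1)}(t_{k (N-1), k N})` over all `k` with values in
`{1, …, M}` such that `k 0 = a` and `k N = b`. The value `k m` is `(k m : ℕ) + 1` in the code,
since `Fin M` counts from `0`. -/
def piWord (q : ℝ) (h0 : 0 < q) (h1 : q < 1) (M : ℕ) {N : ℕ} (σ : Fin N → ℕ) (a b : ℕ) :
    L2 (Fin N → ℕ) →L[ℂ] L2 (Fin N → ℕ) :=
  ∑ k : Fin (N + 1) → Fin M,
    if (k 0 : ℕ) + 1 = a ∧ (k (Fin.last N) : ℕ) + 1 = b then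
      tensorOp fun m : Fin N => piS q h0 h1 (σ m) ((k m.castSucc : ℕ) + 1) ((k m.succ : ℕ) + 1)
    else 0

/-- The reduced word `(s_n s_{n-1} ⋯ s_1)(s_{n+1} s_n ⋯ s_2) ⋯ (s_{2n-1} ⋯ s_n)` of length `n²` in
the symmetric group on `2n` letters, for the permutation exchanging the blocks `1, …, n` and
`n+1, …, 2n`. Its letter at the position `m = n * c + r`, with `r < n` and positions counted
from `0`, is `s_{c + n - r}`. -/
def fockWord (n : ℕ) (m : Fin (n ^ 2)) : ℕ := (m : ℕ) / n + n - (m : ℕ) % n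

/-- The operator `𝒯(z_j^i) = q^{i-n} π_u(t_{n+i, n+j})` on `ℓ²(ℕ)^{⊗ n²}`, where `u` is the
permutation with the reduced word `fockWord n`; here `i`, `j` count from `0`. -/
def fockOp (n : ℕ) (q : ℝ) (h0 : 0 < q) (h1 : q < 1) (i j : Fin n) :
    L2 (Fin (n ^ 2) → ℕ) →L[ℂ] L2 (Fin (n ^ 2) → ℕ) :=
  ((q : ℂ) ^ (((i : ℕ) + 1 : ℤ) - (n : ℤ))) •
    piWord q h0 h1 (2 * n) (fockWord n) (n + ((i : ℕ) + 1)) (n + ((j : ℕ) + 1))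

end QMatBall

end

noncomputable section

namespace QMatBall

set_option linter.unusedSectionVars false

/-! ### Operators on `ℓ²` and their matrix coefficients -/

/-! The operators π_u(t_{a,b}) form a 2n × 2n matrix over the bounded operators, and this matrix is
a product with one factor for each letter of the word. A factor differs from the identity only in an
adjacent 2 × 2 block and acts on its own tensor factor. Each such factor is unitary and satisfies
the exchange relations of quantum matrices (`isUnitaryMatrix_piMat`, `isRTT_piMat`). Unitarity
passes to products. The exchange relations pass to products whose factors have mutually commuting
entries (`IsRTT.mul`).

Let t be the resulting unitary quantum matrix. The relations among the z are the exchange relations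
of its lower right n × n block, rescaled row by row. For the relations between z^* and z, multiply
the exchange relation by adjoints of entries on both sides and sum; unitarity collapses the sums
(`IsRTT.mixed`). Sums over larger indices stay inside the block, while the remaining ones are
removed by column orthogonality. What is left in a fixed row index is a triangular system, and the
scaling q^{i-n} turns its solution into the stated R-matrix form (`IsRTT.block_relation`).

The vector e_0 ⊗ ⋯ ⊗ e_0 is killed by all adjoints (`star_fockOp_vacuum`). It is cyclic: if all
blocks after the i-th are in the vacuum state, a suitable operator of row i raises any chosen
position of block i by one, up to a nonzero scalar (`fockOp_create`). This gives a Fock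
representation.

For uniqueness, every element is a combination of normally ordered words (`mem_normalOrdered`), so
the vacuum expectation is the same in all Fock representations. It determines the inner products on
the Fock module, hence a unitary intertwiner (`FockRep.unitaryEquiv`). Finally d(q) and 1 - C_q are
diagonal with entries tending to 0, hence lie in C*(S), so every elementary tensor in the operators
does too (`fockOp_mem_toeplitzTensor`). -/

theorem L2.ext_single {α : Type*} [DecidableEq α] {E : Type*} [AddCommMonoid E] [Module ℂ E]
    [TopologicalSpace E] [T2Space E] {T T' : L2 α →L[ℂ] E}
    (h : ∀ f, T (lp.single 2 f (1 : ℂ)) = T' (lp.single 2 f (1 : ℂ))) : T = T' := by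
  ext x
  have hx := lp.hasSum_single (E := fun _ : α => ℂ) (p := 2) ENNReal.ofNat_ne_top x
  have hs : ∀ a, lp.single (E := fun _ : α => ℂ) 2 a (x a) = x a • lp.single 2 a (1 : ℂ) := by
    intro a
    rw [← lp.single_smul, smul_eq_mul, mul_one]
  simp only [hs] at hx
  have h1 := hx.mapL T
  have h2 := hx.mapL T'
  simp only [map_smul, h] at h1 h2
  exact h1.unique h2

theorem star_single_apply {α : Type*} [DecidableEq α] (T : L2 α →L[ℂ] L2 α) (f g : α) :
    star T (lp.single 2 f (1 : ℂ)) g = star (T (lp.single 2 g (1 : ℂ)) f) := by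
  have h := ContinuousLinearMap.adjoint_inner_right T (lp.single 2 g (1 : ℂ)) (lp.single 2 f (1 : ℂ))
  rw [lp.inner_single_left, lp.inner_single_right] at h
  simpa [ContinuousLinearMap.star_eq_adjoint] using h

theorem slice_update {ι : Type*} [DecidableEq ι] (i : ι) (g : ι → ℕ) (k : ℕ) (x : L2 (ι → ℕ)) :
    slice i (Function.update g i k) x = slice i g x := by
  ext l; simp [slice_apply]

theorem site_mul {ι : Type*} [DecidableEq ι] (i : ι) (A B : L2 ℕ →L[ℂ] L2 ℕ) :
    site i (A * B) = site i A * site i B := by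
  ext x g
  have h : slice i g (site i B x) = B (slice i g x) := by
    ext k
    rw [slice_apply, site_apply, slice_update, Function.update_self]
  change A (B (slice i g x)) (g i) = A (slice i g (site i B x)) (g i)
  rw [h]

theorem site_one {ι : Type*} [DecidableEq ι] (i : ι) : site i (1 : L2 ℕ →L[ℂ] L2 ℕ) = 1 := by
  ext x g
  rw [site_apply]
  simp [slice_apply]

/-- The operators acting on a single tensor factor, as an algebra homomorphism. -/
def siteHom {ι : Type*} [DecidableEq ι] (i : ι) :
    (L2 ℕ →L[ℂ] L2 ℕ) →ₐ[ℂ] (L2 (ι → ℕ) →L[ℂ] L2 (ι → ℕ)) :=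
  AlgHom.ofLinearMap
    { toFun := site i
      map_add' := fun A B => by ext x g; rfl
      map_smul' := fun c A => by ext x g; rfl }
    (site_one i) (site_mul i)

theorem siteHom_apply {ι : Type*} [DecidableEq ι] (i : ι) (A : L2 ℕ →L[ℂ] L2 ℕ) :
    siteHom i A = site i A := rfl

theorem site_single {N : ℕ} (i : Fin N) (A : L2 ℕ →L[ℂ] L2 ℕ) (f g : Fin N → ℕ) :
    site i A (lp.single 2 f (1 : ℂ)) g
      = if ∀ m, m ≠ i → g m = f m then A (lp.single 2 (f i) (1 : ℂ)) (g i) else 0 := by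
  simpa using list_site_single (fun _ => A) f [i] (List.nodup_singleton i) g

theorem site_star {N : ℕ} (i : Fin N) (A : L2 ℕ →L[ℂ] L2 ℕ) :
    site i (star A) = star (site i A) := by
  refine L2.ext_single fun f => ?_
  ext g
  rw [star_single_apply, site_single, site_single, star_single_apply]
  have h : (∀ m, m ≠ i → g m = f m) ↔ (∀ m, m ≠ i → f m = g m) :=
    forall₂_congr fun m _ => eq_comm
  simp only [h]
  split_ifs <;> simp

theorem site_commute {N : ℕ} {i j : Fin N} (hij : i ≠ j) (A B : L2 ℕ →L[ℂ] L2 ℕ) :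
    Commute (site i A) (site j B) := by
  refine L2.ext_single fun f => ?_
  ext g
  -- A single family, `A` at `i` and `B` elsewhere, lets both orders of the product be read off from
  -- the same formula for matrix coefficients.
  have h1 := list_site_single (fun m => if m = i then A else B) f [i, j] (by simp [hij]) g
  have h2 := list_site_single (fun m => if m = i then A else B) f [j, i] (by simp [hij.symm]) g
  simp only [List.map_cons, List.map_nil, List.prod_cons, List.prod_nil, mul_one, if_pos,
    if_neg hij.symm] at h1 h2
  rw [h1, h2]
  have h : (∀ m, m ∉ [i, j] → g m = f m) ↔ (∀ m, m ∉ [j, i] → g m = f m) :=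
    forall_congr' fun m => by simp [or_comm]
  simp only [h, mul_comm]

/-- If `A` sends `e_{f i}` to a multiple of a basis vector, then so does `site i A`. -/
theorem site_single_of_apply {N : ℕ} (i : Fin N) {A : L2 ℕ →L[ℂ] L2 ℕ} {f : Fin N → ℕ} {c : ℂ}
    {k : ℕ} (h : A (lp.single 2 (f i) (1 : ℂ)) = c • lp.single 2 k (1 : ℂ)) :
    site i A (lp.single 2 f (1 : ℂ)) = c • lp.single 2 (Function.update f i k) (1 : ℂ) := by
  ext g
  rw [site_single, h]
  simp only [lp.coeFn_smul, Pi.smul_apply, smul_eq_mul]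
  have hc : g = Function.update f i k ↔ (∀ m, m ≠ i → g m = f m) ∧ g i = k := by
    rw [Function.eq_update_iff, and_comm]
  by_cases h1 : ∀ m, m ≠ i → g m = f m
  · rw [if_pos h1]
    by_cases h2 : g i = k
    · rw [hc.2 ⟨h1, h2⟩]; simp [lp.single_apply]
    · rw [lp.single_apply_ne _ _ _ h2, lp.single_apply_ne _ _ _ fun h3 => h2 (hc.1 h3).2]
  · rw [if_neg h1, lp.single_apply_ne _ _ _ fun h3 => h1 (hc.1 h3).1, mul_zero]

/-! ### The shift and diagonal operators -/

theorem shift_single (k : ℕ) : shift (lp.single 2 k (1 : ℂ)) = lp.single 2 (k + 1) (1 : ℂ) := by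
  ext m
  rw [shift, mkOp_apply]
  rcases m with _ | m
  · simp [lp.single_apply]
  · by_cases h : m = k
    · simp [lp.single_apply, h]
    · simp [lp.single_apply, h]

theorem star_shift_single_zero : star shift (lp.single 2 0 (1 : ℂ)) = 0 := by
  ext m
  rw [star_single_apply, shift_single]
  simp [lp.single_apply]

theorem star_shift_single_succ (k : ℕ) :
    star shift (lp.single 2 (k + 1) (1 : ℂ)) = lp.single 2 k (1 : ℂ) := by
  ext m
  rw [star_single_apply, shift_single]
  by_cases h : m = k
  · simp [lp.single_apply, h]
  · have : k ≠ m := fun h' => h h'.symm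
    simp [lp.single_apply, h, this]

theorem diag_apply (a : ℕ → ℂ) (ha : ∀ k, ‖a k‖ ≤ 1) (x : L2 ℕ) (k : ℕ) :
    diag a ha x k = a k * x k := rfl

theorem diag_single (a : ℕ → ℂ) (ha : ∀ k, ‖a k‖ ≤ 1) (k : ℕ) :
    diag a ha (lp.single 2 k (1 : ℂ)) = a k • lp.single 2 k (1 : ℂ) := by
  ext m
  rw [diag_apply]
  by_cases h : m = k
  · simp [h]
  · simp [lp.single_apply, h]

theorem star_diag (a : ℕ → ℂ) (ha : ∀ k, ‖a k‖ ≤ 1) (hr : ∀ k, star (a k) = a k) :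
    star (diag a ha) = diag a ha := by
  refine L2.ext_single fun f => ?_
  ext g
  rw [star_single_apply, diag_apply, diag_apply, star_mul', hr]
  by_cases h : f = g
  · simp [h]
  · have h' : g ≠ f := fun h' => h h'.symm
    simp [lp.single_apply, h, h']

theorem star_opC (q : ℝ) (h0 : 0 < q) : star (opC q h0) = opC q h0 :=
  star_diag _ _ fun _ => Complex.conj_ofReal _

theorem star_opD (q : ℝ) (h0 : 0 < q) (h1 : q < 1) : star (opD q h0 h1) = opD q h0 h1 :=
  star_diag _ _ fun _ => Complex.conj_ofReal _

theorem opC_single (q : ℝ) (h0 : 0 < q) (k : ℕ) : opC q h0 (lp.single 2 k (1 : ℂ)) =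
    ((Real.sqrt (1 - q ^ (2 * k)) : ℝ) : ℂ) • lp.single 2 k (1 : ℂ) := diag_single _ _ k

theorem opD_single (q : ℝ) (h0 : 0 < q) (h1 : q < 1) (k : ℕ) :
    opD q h0 h1 (lp.single 2 k (1 : ℂ)) = ((q : ℂ) ^ k) • lp.single 2 k (1 : ℂ) := by
  rw [opD, diag_single, Complex.ofReal_pow]

/-- The creation operator `C_q S`. -/
def opA (q : ℝ) (h0 : 0 < q) : L2 ℕ →L[ℂ] L2 ℕ := opC q h0 * shift

theorem star_opA (q : ℝ) (h0 : 0 < q) : star (opA q h0) = star shift * opC q h0 := by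
  rw [opA, star_mul, star_opC]

theorem opA_single (q : ℝ) (h0 : 0 < q) (k : ℕ) : opA q h0 (lp.single 2 k (1 : ℂ)) =
    ((Real.sqrt (1 - q ^ (2 * (k + 1))) : ℝ) : ℂ) • lp.single 2 (k + 1) (1 : ℂ) := by
  change opC q h0 (shift _) = _
  rw [shift_single, opC_single]

theorem star_opA_single_zero (q : ℝ) (h0 : 0 < q) :
    star (opA q h0) (lp.single 2 0 (1 : ℂ)) = 0 := by
  rw [star_opA]
  change star shift (opC q h0 _) = _
  rw [opC_single, map_smul, star_shift_single_zero, smul_zero]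

theorem star_opA_single_succ (q : ℝ) (h0 : 0 < q) (k : ℕ) :
    star (opA q h0) (lp.single 2 (k + 1) (1 : ℂ)) =
      ((Real.sqrt (1 - q ^ (2 * (k + 1))) : ℝ) : ℂ) • lp.single 2 k (1 : ℂ) := by
  rw [star_opA]
  change star shift (opC q h0 _) = _
  rw [opC_single, map_smul, star_shift_single_succ]

theorem sqrt_mul_self_ofReal (q : ℝ) (h0 : 0 < q) (h1 : q < 1) (k : ℕ) :
    ((Real.sqrt (1 - q ^ (2 * k)) : ℝ) : ℂ) * ((Real.sqrt (1 - q ^ (2 * k)) : ℝ) : ℂ)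
      = 1 - (q : ℂ) ^ (2 * k) := by
  rw [← Complex.ofReal_mul, Real.mul_self_sqrt]
  · push_cast; ring
  · have : q ^ (2 * k) ≤ 1 := pow_le_one₀ h0.le h1.le
    linarith

/-- With `star_mul_opA`, `opD_mul_opA` and `star_opA_mul_opD`, these are the quantum SU(2)
relations. They are all that is used about the nontrivial 2 × 2 block. -/
theorem opA_mul_star (q : ℝ) (h0 : 0 < q) (h1 : q < 1) :
    opA q h0 * star (opA q h0) = 1 - opD q h0 h1 * opD q h0 h1 := by
  refine L2.ext_single fun k => ?_
  change opA q h0 (star (opA q h0) _) = _ - opD q h0 h1 (opD q h0 h1 _)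
  -- At `k = 0` the adjoint kills e_0, in agreement with 1 - q^0 = 0.
  rcases k with _ | k
  · simp [star_opA_single_zero, opD_single]
  · rw [star_opA_single_succ, map_smul, opA_single, smul_smul, sqrt_mul_self_ofReal q h0 h1,
      opD_single, map_smul, opD_single, smul_smul, sub_smul, one_smul, ← pow_add, two_mul]
    rfl

theorem star_mul_opA (q : ℝ) (h0 : 0 < q) (h1 : q < 1) :
    star (opA q h0) * opA q h0 = 1 - ((q : ℂ) ^ 2) • (opD q h0 h1 * opD q h0 h1) := by
  refine L2.ext_single fun k => ?_
  change star (opA q h0) (opA q h0 _) = _ - (q : ℂ) ^ 2 • opD q h0 h1 (opD q h0 h1 _)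
  rw [opA_single, map_smul, star_opA_single_succ, smul_smul, sqrt_mul_self_ofReal q h0 h1,
    opD_single, map_smul, opD_single, smul_smul, smul_smul, sub_smul, one_smul]
  congr 2
  ring

theorem opD_mul_opA (q : ℝ) (h0 : 0 < q) (h1 : q < 1) :
    opD q h0 h1 * opA q h0 = (q : ℂ) • (opA q h0 * opD q h0 h1) := by
  refine L2.ext_single fun k => ?_
  change opD q h0 h1 (opA q h0 _) = (q : ℂ) • opA q h0 (opD q h0 h1 _)
  rw [opA_single, map_smul, opD_single, opD_single, map_smul, opA_single, smul_smul, smul_smul,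
    smul_smul]
  congr 1
  ring

theorem star_opA_mul_opD (q : ℝ) (h0 : 0 < q) (h1 : q < 1) :
    star (opA q h0) * opD q h0 h1 = (q : ℂ) • (opD q h0 h1 * star (opA q h0)) := by
  have h := congrArg star (opD_mul_opA q h0 h1)
  simpa [star_mul, star_opD] using h

/-! ### Membership in the Toeplitz algebra -/

theorem shift_mem_toeplitz : shift ∈ toeplitz :=
  StarSubalgebra.le_topologicalClosure _ (StarAlgebra.subset_adjoin ℂ _ rfl)

theorem norm_diag_le {a : ℕ → ℂ} (ha : ∀ k, ‖a k‖ ≤ 1) {ε : ℝ} (hε : 0 ≤ ε)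
    (h : ∀ k, ‖a k‖ ≤ ε) : ‖diag a ha‖ ≤ ε := by
  refine ContinuousLinearMap.opNorm_le_bound _ hε fun x => ?_
  rw [← Real.norm_of_nonneg hε, ← norm_smul ε x]
  refine lp.norm_mono (p := 2) (by norm_num) fun k => ?_
  rw [diag_apply, norm_mul, lp.coeFn_smul, Pi.smul_apply, norm_smul, Real.norm_of_nonneg hε]
  exact mul_le_mul_of_nonneg_right (h k) (norm_nonneg _)

/-- The matrix unit `e_k ⊗ e_k^*` as a polynomial in the shift. -/
theorem shift_proj_single (k m : ℕ) :
    (shift ^ k * (1 - shift * star shift) * star shift ^ k) (lp.single 2 m (1 : ℂ)) =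
      if m = k then lp.single 2 m (1 : ℂ) else 0 := by
  induction k generalizing m with
  | zero =>
    rw [pow_zero, pow_zero, one_mul, mul_one]
    change _ - shift (star shift _) = _
    rcases m with _ | m
    · rw [star_shift_single_zero, map_zero, if_pos rfl, sub_zero]; rfl
    · rw [star_shift_single_succ, shift_single, if_neg (by simp)]; exact sub_self _
  | succ k ih =>
    have h : shift ^ (k + 1) * (1 - shift * star shift) * star shift ^ (k + 1) =
        shift * (shift ^ k * (1 - shift * star shift) * star shift ^ k) * star shift := by
      rw [pow_succ', pow_succ]; simp only [mul_assoc]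
    rw [h]
    change shift ((shift ^ k * (1 - shift * star shift) * star shift ^ k) (star shift _)) = _
    rcases m with _ | m
    · rw [star_shift_single_zero, map_zero, map_zero, if_neg (by simp)]
    · rw [star_shift_single_succ, ih]
      by_cases hm : m = k
      · simp [hm, shift_single]
      · simp [hm]

/-- The partial sums of a_k times the k-th diagonal matrix unit are polynomials in the shift and its
adjoint. They converge in norm because the remainder is diagonal, with norm bounded by the supremum
of the tail of `a`. -/
theorem diag_mem_toeplitz {a : ℕ → ℂ} (ha : ∀ k, ‖a k‖ ≤ 1)
    (h : Filter.Tendsto a Filter.atTop (nhds 0)) : diag a ha ∈ toeplitz := by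
  let T : ℕ → (L2 ℕ →L[ℂ] L2 ℕ) := fun K =>
    ∑ k ∈ Finset.range K, a k • (shift ^ k * (1 - shift * star shift) * star shift ^ k)
  have hT : ∀ K, T K ∈ toeplitz := fun K => by
    have hs := shift_mem_toeplitz
    have hs' : star shift ∈ toeplitz := star_mem hs
    exact sum_mem fun k _ => SMulMemClass.smul_mem _
      (mul_mem (mul_mem (pow_mem hs k) (sub_mem (one_mem _) (mul_mem hs hs'))) (pow_mem hs' k))
  have hb : ∀ K k, ‖(if k < K then 0 else a k)‖ ≤ 1 := fun K k => by
    split_ifs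
    · simp
    · exact ha k
  have hd : ∀ K, diag a ha - T K = diag (fun k => if k < K then 0 else a k) (hb K) := by
    intro K
    refine L2.ext_single fun m => ?_
    have hTK : T K (lp.single 2 m (1 : ℂ)) = if m < K then a m • lp.single 2 m (1 : ℂ) else 0 := by
      simp only [T, sum_apply, smul_apply, shift_proj_single, smul_ite,
        smul_zero]
      simp [Finset.sum_ite_eq]
    change diag a ha _ - T K _ = _
    rw [hTK, diag_single, diag_single]
    split_ifs <;> simp
  have hlim : Filter.Tendsto T Filter.atTop (nhds (diag a ha)) := by
    rw [Metric.tendsto_atTop]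
    intro ε hε
    obtain ⟨K, hK⟩ := Metric.tendsto_atTop.1 h (ε / 2) (by positivity)
    refine ⟨K, fun M hM => ?_⟩
    rw [dist_comm, dist_eq_norm, hd]
    refine lt_of_le_of_lt (norm_diag_le _ (half_pos hε).le fun k => ?_) (half_lt_self hε)
    split_ifs with hk
    · simpa using (half_pos hε).le
    · have := hK k (hM.trans (not_lt.1 hk))
      rw [dist_zero_right] at this
      exact this.le
  exact (StarSubalgebra.isClosed_topologicalClosure _).mem_of_tendsto hlim
    (Filter.Eventually.of_forall hT)

theorem opD_mem_toeplitz (q : ℝ) (h0 : 0 < q) (h1 : q < 1) : opD q h0 h1 ∈ toeplitz := by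
  refine diag_mem_toeplitz _ ?_
  rw [← Complex.ofReal_zero]
  exact (Complex.continuous_ofReal.tendsto 0).comp (tendsto_pow_atTop_nhds_zero_of_lt_one h0.le h1)

theorem opC_mem_toeplitz (q : ℝ) (h0 : 0 < q) (h1 : q < 1) : opC q h0 ∈ toeplitz := by
  have hq : ∀ k : ℕ, 0 ≤ 1 - q ^ (2 * k) ∧ 1 - q ^ (2 * k) ≤ 1 := fun k =>
    ⟨sub_nonneg.2 (pow_le_one₀ h0.le h1.le), by have : 0 ≤ q ^ (2 * k) := by positivity
                                                linarith⟩
  have hb : ∀ k : ℕ, ‖(1 - (Real.sqrt (1 - q ^ (2 * k)) : ℂ))‖ ≤ 1 := fun k => by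
    rw [← Complex.ofReal_one, ← Complex.ofReal_sub, Complex.norm_real, Real.norm_of_nonneg]
    · linarith [Real.sqrt_nonneg (1 - q ^ (2 * k))]
    · exact sub_nonneg.2 (Real.sqrt_le_one.2 (hq k).2)
  -- The entries of C_q tend to 1 rather than 0, so the previous criterion is applied to 1 - C_q.
  have hm : diag (fun k => 1 - (Real.sqrt (1 - q ^ (2 * k)) : ℂ)) hb ∈ toeplitz := by
    refine diag_mem_toeplitz _ ?_
    have h2 : Filter.Tendsto (fun k : ℕ => q ^ (2 * k)) Filter.atTop (nhds 0) := by
      simp only [pow_mul]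
      exact tendsto_pow_atTop_nhds_zero_of_lt_one (by positivity) (by nlinarith)
    have h3 : Filter.Tendsto (fun k : ℕ => ((1 - Real.sqrt (1 - q ^ (2 * k)) : ℝ) : ℂ))
        Filter.atTop (nhds ((1 - Real.sqrt (1 - 0) : ℝ) : ℂ)) :=
      (Complex.continuous_ofReal.tendsto _).comp
        (tendsto_const_nhds.sub (tendsto_const_nhds.sub h2).sqrt)
    simpa using h3
  have h : opC q h0 = 1 - diag (fun k => 1 - (Real.sqrt (1 - q ^ (2 * k)) : ℂ)) hb := by
    refine L2.ext_single fun k => ?_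
    change _ = _ - diag _ _ _
    rw [opC_single, diag_single, sub_smul, one_smul]
    exact (sub_sub_cancel _ _).symm
  rw [h]
  exact sub_mem (one_mem _) hm

theorem piS_mem_toeplitz (q : ℝ) (h0 : 0 < q) (h1 : q < 1) (s a b : ℕ) :
    piS q h0 h1 s a b ∈ toeplitz := by
  have hs := shift_mem_toeplitz
  have hs' : star shift ∈ toeplitz := star_mem hs
  unfold piS
  split_ifs
  · exact mul_mem hs' (opC_mem_toeplitz q h0 h1)
  · exact SMulMemClass.smul_mem _ (opD_mem_toeplitz q h0 h1)
  · exact neg_mem (opD_mem_toeplitz q h0 h1)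
  · exact mul_mem (opC_mem_toeplitz q h0 h1) hs
  · exact one_mem _
  · exact zero_mem _

theorem fockOp_mem_toeplitzTensor (n : ℕ) (q : ℝ) (h0 : 0 < q) (h1 : q < 1) (i j : Fin n) :
    fockOp n q h0 h1 i j ∈ toeplitzTensor (n ^ 2) := by
  refine SMulMemClass.smul_mem _ (sum_mem fun k _ => ?_)
  split_ifs
  · exact StarSubalgebra.le_topologicalClosure _
      (StarAlgebra.subset_adjoin ℂ _ ⟨_, fun m => piS_mem_toeplitz q h0 h1 _ _ _, rfl⟩)
  · exact zero_mem _

/-! ### Unitary quantum matrices -/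

section
variable {ι A : Type*} [Fintype ι] [LinearOrder ι] [Ring A] [Algebra ℂ A]

/-- The entries of `t` satisfy the relations of the algebra of quantum matrices. -/
def IsRTT (q : ℂ) (t : Matrix ι ι A) : Prop := ∀ α β a b,
  (if α = β then q else 1) • (t β a * t α b) + (if α < β then q - q⁻¹ else 0) • (t α a * t β b) =
  (if a = b then q else 1) • (t α b * t β a) + (if a < b then q - q⁻¹ else 0) • (t α a * t β b)

theorem IsRTT.one (q : ℂ) : IsRTT q (1 : Matrix ι ι A) := by
  intro α β a b
  simp only [Matrix.one_apply]
  by_cases h1 : α = a <;> by_cases h2 : β = b <;> by_cases h3 : β = a <;> by_cases h4 : α = b <;>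
    simp_all

theorem mul_apply_mul_mul_apply {t s : Matrix ι ι A} (h : ∀ a b c d, Commute (t a b) (s c d))
    (α β a b : ι) : (t * s) α a * (t * s) β b =
      ∑ c, ∑ d, (t α c * t β d) * (s c a * s d b) := by
  simp only [Matrix.mul_apply, Finset.sum_mul_sum]
  refine Finset.sum_congr rfl fun c _ => Finset.sum_congr rfl fun d _ => ?_
  rw [mul_assoc, mul_assoc, ← mul_assoc (s c a), ← (h β d c a).eq, mul_assoc]

/-- The coproduct argument: exchange the rows in `t` at the cost of swapping the intermediate
indices `c`, `d`, then absorb that swap by the relations of `s`. -/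
theorem IsRTT.mul {q : ℂ} {t s : Matrix ι ι A} (ht : IsRTT q t) (hs : IsRTT q s)
    (h : ∀ a b c d, Commute (t a b) (s c d)) : IsRTT q (t * s) := by
  intro α β a b
  simp only [mul_apply_mul_mul_apply h]
  have e1 : ∀ c d, (if α = β then q else 1) • (t β c * t α d * (s c a * s d b)) +
      (if α < β then q - q⁻¹ else 0) • (t α c * t β d * (s c a * s d b)) =
      (if c = d then q else 1) • (t α d * t β c * (s c a * s d b)) +
      (if c < d then q - q⁻¹ else 0) • (t α c * t β d * (s c a * s d b)) := by
    intro c d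
    simpa only [add_mul, smul_mul_assoc] using congrArg (· * (s c a * s d b)) (ht α β c d)
  have e2 : ∀ c d, (if a = b then q else 1) • (t α c * t β d * (s c b * s d a)) +
      (if a < b then q - q⁻¹ else 0) • (t α c * t β d * (s c a * s d b)) =
      (if d = c then q else 1) • (t α c * t β d * (s d a * s c b)) +
      (if c < d then q - q⁻¹ else 0) • (t α c * t β d * (s c a * s d b)) := by
    intro c d
    have := congrArg (t α c * t β d * ·) (hs c d a b)
    simp only [mul_add, mul_smul_comm] at this
    rw [← this, if_congr (eq_comm (a := d)) rfl rfl]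
  simp only [Finset.smul_sum, ← Finset.sum_add_distrib, e1, e2]
  simp only [Finset.sum_add_distrib]
  rw [Finset.sum_comm]

/-- In this and the next three lemmas the index pairs fed to `IsRTT` are ordered so that the
unwanted q - q⁻¹ terms vanish. -/
theorem IsRTT.col {q : ℂ} {t : Matrix ι ι A} (h : IsRTT q t) {α β a : ι} (hl : α < β) :
    t α a * t β a = q • (t β a * t α a) := by
  have := h β α a a
  simpa [hl.ne', hl.not_gt] using this

theorem IsRTT.row {q : ℂ} {t : Matrix ι ι A} (h : IsRTT q t) {α a b : ι} (hl : a < b) :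
    t α a * t α b = q • (t α b * t α a) := by
  have := h α α b a
  simpa [hl.ne', hl.not_gt] using this.symm

theorem IsRTT.comm {q : ℂ} {t : Matrix ι ι A} (h : IsRTT q t) {α β a b : ι} (hl : α < β)
    (hl' : b < a) : t α a * t β b = t β b * t α a := by
  have := h α β b a
  simpa [hl, hl.ne, hl'.ne, hl'] using this.symm

theorem IsRTT.cross {q : ℂ} {t : Matrix ι ι A} (h : IsRTT q t) {α β a b : ι} (hl : α < β)
    (hl' : a < b) : t α a * t β b = t β b * t α a + (q - q⁻¹) • (t β a * t α b) := by
  have := h α β b a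
  rw [← h.comm hl hl']
  simpa [hl, hl.ne, hl'.ne', hl'.not_gt] using this.symm

/-! ### Unitarity and the relations between entries and their adjoints. -/

variable [StarRing A]

/-- The matrix `t` over a `*`-ring is unitary. -/
structure IsUnitaryMatrix (t : Matrix ι ι A) : Prop where
  mul_star : t * star t = 1
  star_mul : star t * t = 1

theorem IsUnitaryMatrix.one : IsUnitaryMatrix (1 : Matrix ι ι A) := ⟨by simp, by simp⟩

theorem IsUnitaryMatrix.mul {t s : Matrix ι ι A} (ht : IsUnitaryMatrix t)
    (hs : IsUnitaryMatrix s) : IsUnitaryMatrix (t * s) where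
  mul_star := by
    rw [StarMul.star_mul, mul_assoc, ← mul_assoc s, hs.mul_star, one_mul, ht.mul_star]
  star_mul := by
    rw [StarMul.star_mul, mul_assoc, ← mul_assoc (star t), ht.star_mul, one_mul, hs.star_mul]

theorem IsUnitaryMatrix.row_sum {t : Matrix ι ι A} (h : IsUnitaryMatrix t) (α β : ι) :
    ∑ b, t α b * star (t β b) = if α = β then 1 else 0 := by
  have := congrFun (congrFun h.mul_star α) β
  simpa [Matrix.mul_apply, Matrix.star_apply, Matrix.one_apply] using this

theorem IsUnitaryMatrix.col_sum {t : Matrix ι ι A} (h : IsUnitaryMatrix t) (a b : ι) :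
    ∑ α, star (t α a) * t α b = if a = b then 1 else 0 := by
  have := congrFun (congrFun h.star_mul a) b
  simpa [Matrix.mul_apply, Matrix.star_apply, Matrix.one_apply] using this

/-- Multiply the exchange relation for α, β, a, b by t_{αx}^* on the left and t_{yb}^* on the right,
and sum over α and b. On each side unitarity collapses one of the two sums, leaving a main term and
a partial sum. -/
theorem IsRTT.mixed {q : ℂ} {t : Matrix ι ι A} (h : IsRTT q t) (hu : IsUnitaryMatrix t)
    (y x β a : ι) :
    (if y = β then q else 1) • (star (t y x) * t β a) +
      (if y = β then (q - q⁻¹) • ∑ j with j < y, star (t j x) * t j a else 0) =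
    (if a = x then q else 1) • (t β a * star (t y x)) +
      (if a = x then (q - q⁻¹) • ∑ j with x < j, t β j * star (t y j) else 0) := by
  have e1 : ∑ α, ∑ b, star (t α x) * ((if α = β then q else 1) • (t β a * t α b) +
      (if α < β then q - q⁻¹ else 0) • (t α a * t β b)) * star (t y b) =
      (if y = β then q else 1) • (star (t y x) * t β a) +
      (if y = β then (q - q⁻¹) • ∑ j with j < y, star (t j x) * t j a else 0) := by
    have : ∀ α, ∑ b, star (t α x) * ((if α = β then q else 1) • (t β a * t α b) +
      (if α < β then q - q⁻¹ else 0) • (t α a * t β b)) * star (t y b) =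
      (if α = y then (if α = β then q else 1) • (star (t α x) * t β a) else 0) +
      (if β = y then (if α < β then (q - q⁻¹) • (star (t α x) * t α a) else 0) else 0) := by
      intro α
      have : ∀ b, star (t α x) * ((if α = β then q else 1) • (t β a * t α b) +
        (if α < β then q - q⁻¹ else 0) • (t α a * t β b)) * star (t y b) =
        (if α = β then q else 1) • ((star (t α x) * t β a) * (t α b * star (t y b))) +
        (if α < β then q - q⁻¹ else 0) • ((star (t α x) * t α a) * (t β b * star (t y b))) := by
        intro b
        simp only [mul_add, add_mul, mul_smul_comm, smul_mul_assoc, mul_assoc]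
      simp only [this, Finset.sum_add_distrib, ← Finset.smul_sum, ← Finset.mul_sum, hu.row_sum]
      congr 1
      · split_ifs <;> simp
      · split_ifs <;> simp
    simp only [this, Finset.sum_add_distrib, Finset.sum_ite_eq', Finset.mem_univ, if_true]
    congr 1
    by_cases hy : y = β
    · subst hy
      simp only [if_true, ← Finset.sum_filter, Finset.smul_sum]
    · have : β ≠ y := fun h => hy h.symm
      simp [hy, this]
  have e2 : ∑ α, ∑ b, star (t α x) * ((if a = b then q else 1) • (t α b * t β a) +
      (if a < b then q - q⁻¹ else 0) • (t α a * t β b)) * star (t y b) =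
      (if a = x then q else 1) • (t β a * star (t y x)) +
      (if a = x then (q - q⁻¹) • ∑ j with x < j, t β j * star (t y j) else 0) := by
    rw [Finset.sum_comm]
    have : ∀ b, ∑ α, star (t α x) * ((if a = b then q else 1) • (t α b * t β a) +
      (if a < b then q - q⁻¹ else 0) • (t α a * t β b)) * star (t y b) =
      (if x = b then (if a = b then q else 1) • (t β a * star (t y b)) else 0) +
      (if x = a then (if a < b then (q - q⁻¹) • (t β b * star (t y b)) else 0) else 0) := by
      intro b
      have : ∀ α, star (t α x) * ((if a = b then q else 1) • (t α b * t β a) +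
        (if a < b then q - q⁻¹ else 0) • (t α a * t β b)) * star (t y b) =
        (if a = b then q else 1) • ((star (t α x) * t α b) * (t β a * star (t y b))) +
        (if a < b then q - q⁻¹ else 0) • ((star (t α x) * t α a) * (t β b * star (t y b))) := by
        intro α
        simp only [mul_add, add_mul, mul_smul_comm, smul_mul_assoc, mul_assoc]
      simp only [this, Finset.sum_add_distrib, ← Finset.smul_sum, ← Finset.sum_mul, hu.col_sum]
      congr 1
      · split_ifs <;> simp
      · split_ifs <;> simp
    simp only [this, Finset.sum_add_distrib, Finset.sum_ite_eq, Finset.mem_univ, if_true]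
    congr 1
    by_cases hy : a = x
    · subst hy
      simp only [if_true, ← Finset.sum_filter, Finset.smul_sum]
    · have : x ≠ a := fun h => hy h.symm
      simp [hy, this]
  rw [← e1, ← e2]
  exact Finset.sum_congr rfl fun α _ => Finset.sum_congr rfl fun b _ => by rw [h α β a b]

/-- The mixed relations in a fixed row, solved by means of the unitarity for the rows below it. -/
theorem IsRTT.mixed_row {q : ℂ} {t : Matrix ι ι A} (h : IsRTT q t)
    (hu : IsUnitaryMatrix t) (y x a : ι) :
    q⁻¹ • (star (t y x) * t y a) - (q - q⁻¹) • ∑ j with y < j, star (t j x) * t j a +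
      (if a = x then algebraMap ℂ A (q - q⁻¹) else 0) =
    (if a = x then q else 1) • (t y a * star (t y x)) +
      (if a = x then (q - q⁻¹) • ∑ j with x < j, t y j * star (t y j) else 0) := by
  rw [← h.mixed hu y x y a, if_pos rfl, if_pos rfl]
  have hs := hu.col_sum x a
  have hsplit : ∑ j, star (t j x) * t j a = ∑ j with j < y, star (t j x) * t j a +
      star (t y x) * t y a + ∑ j with y < j, star (t j x) * t j a := by
    rw [← Finset.sum_filter_add_sum_filter_not Finset.univ (fun j => j < y), add_assoc]
    congr 1
    have : (Finset.univ.filter fun j => ¬ j < y) = insert y (Finset.univ.filter fun j => y < j) := by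
      ext j; simp [le_iff_eq_or_lt, eq_comm]
    rw [this, Finset.sum_insert (by simp)]
  -- The rows before `y` may lie outside the lower block; column orthogonality trades them for `y`
  -- and the rows after it.
  have hlt : ∑ j with j < y, star (t j x) * t j a = (if a = x then 1 else 0) -
      star (t y x) * t y a - ∑ j with y < j, star (t j x) * t j a := by
    have hc : (if a = x then (1 : A) else 0) = if x = a then 1 else 0 := by simp only [eq_comm]
    rw [hc, ← hs, hsplit]; abel
  have hl : (if a = x then algebraMap ℂ A (q - q⁻¹) else 0) =
      (q - q⁻¹) • (if a = x then (1 : A) else 0) := by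
    split_ifs
    · rw [Algebra.algebraMap_eq_smul_one]
    · simp
  rw [hlt, hl]
  module

end

/-! ### Blocks of unitary quantum matrices -/

theorem sum_Rcoef {n : ℕ} {A : Type*} [AddCommGroup A] [Module ℂ A] (q : ℝ) (b a : Fin n)
    (f : Fin n → Fin n → A) :
    ∑ a', ∑ b', Rcoef q b a b' a' • f a' b' = if a = b then
      f a a - (((q : ℂ) ^ 2)⁻¹ - 1) • ∑ j with b < j, f j j else (q : ℂ)⁻¹ • f a b := by
  -- The coefficient splits into a part supported at `a' = a`, `b' = b` and, when `a = b`, a part on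
  -- the diagonal `a' = b'` beyond `b`.
  have hR : ∀ a' b', Rcoef q b a b' a' • f a' b' =
      (if a = a' then if b = b' then (if a = b then f a' b' else (q : ℂ)⁻¹ • f a' b') else 0
        else 0) +
      (if a' = b' then if a = b ∧ b < a' then -((((q : ℂ) ^ 2)⁻¹ - 1) • f a' b') else 0 else 0) := by
    intro a' b'
    unfold Rcoef
    by_cases h : a = b
    · subst h
      by_cases h1 : a = a' <;> by_cases h2 : a' = b'
      · subst h1 h2; simp
      · subst h1
        have : ¬ b' = a := fun h => h2 h.symm
        simp [h2, this]
      · subst h2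
        simp [h1, -neg_sub]
      · have : ¬ b' = a' := fun h => h2 h.symm
        simp [h2, this, h1]
    · have h' : ¬ b = a := fun h' => h h'.symm
      simp only [h, h', false_and, if_false, ne_eq, not_false_eq_true, true_and, ite_self, add_zero]
      by_cases h1 : a = a' <;> by_cases h2 : b = b' <;> simp [h1, h2]
  simp only [hR, Finset.sum_add_distrib, Finset.sum_ite_eq, Finset.mem_univ, if_true]
  by_cases h : a = b
  · subst h
    simp only [if_true, true_and]
    rw [sub_eq_add_neg (f a a), Finset.smul_sum, ← Finset.sum_neg_distrib, Finset.sum_filter]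
    congr 1
    rw [Finset.sum_eq_single a (fun c _ hc => by simp [hc.symm]) (by simp)]
    simp
  · simp [h]

section
variable {A : Type*} [Ring A] [Algebra ℂ A]

/-- The relations `h` form a triangular system for the `X`. Since `p` is geometric with ratio q, the
weights q p_j² turn the tail sums of `W` into multiples of the plain tail sums of `X`. The condition
`p n = q`, one step past the last row, makes the formula hold for the empty tail. -/
theorem sum_Ico_solve {q : ℂ} (hq : q ≠ 0) (n : ℕ) (X W : ℕ → A) (p : ℕ → ℂ) (δ : A)
    (hn : p n = q) (hp : ∀ r, p (r + 1) = q * p r)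
    (h : ∀ r < n, W r = q⁻¹ • X r - (q - q⁻¹) • ∑ j ∈ Finset.Ico (r + 1) n, X j + (q - q⁻¹) • δ)
    {r : ℕ} (hr : r ≤ n) :
    ∑ j ∈ Finset.Ico r n, (q * p j ^ 2) • W j =
      p r ^ 2 • ∑ j ∈ Finset.Ico r n, X j + (q ^ 2 - p r ^ 2) • δ := by
  induction hr using Nat.decreasingInduction with
  | self => simp [hn]
  | of_succ r hr ih =>
    rw [Finset.sum_eq_sum_Ico_succ_bot hr, Finset.sum_eq_sum_Ico_succ_bot hr, ih, h r hr, hp]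
    match_scalars <;> field_simp <;> ring

theorem solve_row {q : ℂ} (hq : q ≠ 0) {n : ℕ} (X W : ℕ → A) (p : ℕ → ℂ) (δ : A)
    (hn : p n = q) (hp : ∀ r, p (r + 1) = q * p r)
    (h : ∀ r < n, W r = q⁻¹ • X r - (q - q⁻¹) • ∑ j ∈ Finset.Ico (r + 1) n, X j + (q - q⁻¹) • δ)
    {r : ℕ} (hr : r < n) :
    p r ^ 2 • X r = q • (p r ^ 2 • W r - ((q ^ 2)⁻¹ - 1) • ∑ j ∈ Finset.Ico (r + 1) n, p j ^ 2 • W j)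
      + (1 - q ^ 2) • δ := by
  have h1 := sum_Ico_solve hq n X W p δ hn hp h hr
  simp only [mul_smul, ← Finset.smul_sum] at h1
  have h2 : ∑ j ∈ Finset.Ico (r + 1) n, p j ^ 2 • W j = q⁻¹ • (p (r + 1) ^ 2 •
      ∑ j ∈ Finset.Ico (r + 1) n, X j + (q ^ 2 - p (r + 1) ^ 2) • δ) := by
    rw [← h1, smul_smul, inv_mul_cancel₀ hq, one_smul]
  rw [h2, h r hr, hp]
  match_scalars <;> field_simp <;> ring

theorem sum_fin_lt {n : ℕ} (f : ℕ → A) (r : Fin n) :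
    ∑ j : Fin n with r < j, f j = ∑ j ∈ Finset.Ico ((r : ℕ) + 1) n, f j := by
  rw [Finset.sum_filter]
  have := Fin.sum_univ_eq_sum_range (fun j => if (r : ℕ) < j then f j else 0) n
  simp only [Fin.lt_def, this, ← Finset.sum_filter]
  refine Finset.sum_congr ?_ fun _ _ => rfl
  ext j; simp; omega

/-- By `hup` the image of `e` is closed upwards beyond its points, so partial sums over larger
indices involve the block alone. This is why the lower right block is the right one. -/
theorem sum_lt_of_upper {ι : Type*} [Fintype ι] [LinearOrder ι] {n : ℕ} {e : Fin n → ι}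
    (he : StrictMono e) (hup : ∀ x j, e x < j → ∃ y, e y = j) (f : ι → A) (x : Fin n) :
    ∑ j with e x < j, f j = ∑ y with x < y, f (e y) := by
  symm
  refine Finset.sum_bij (fun y _ => e y) (fun y hy => ?_) (fun _ _ _ _ h => he.injective h)
    (fun j hj => ?_) fun _ _ => rfl
  · simpa using he (by simpa using hy)
  · obtain ⟨y, rfl⟩ := hup x j (by simpa using hj)
    exact ⟨y, by simpa [he.lt_iff_lt] using hj, rfl⟩

variable [StarRing A] [StarModule ℂ A]

/-- The relations between the entries of the scaled lower right block of a unitary quantum matrix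
and their adjoints. -/
theorem IsRTT.block_relation {ι : Type*} [Fintype ι] [LinearOrder ι] {q : ℝ} (hq : (q : ℂ) ≠ 0)
    {t : Matrix ι ι A} (h : IsRTT (q : ℂ) t) (hu : IsUnitaryMatrix t) {n : ℕ} {e : Fin n → ι}
    (he : StrictMono e) (hup : ∀ x j, e x < j → ∃ y, e y = j) {p : ℕ → ℂ} (hn : p n = q)
    (hp : ∀ r, p (r + 1) = q * p r) (hps : ∀ r, star (p r) = p r) {z : Fin n → Fin n → A}
    (hz : ∀ i j, z i j = p i • t (e i) (e j)) (α β a b : Fin n) :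
    star (z β b) * z α a = ((q : ℂ) ^ 2 • (∑ a' : Fin n, ∑ b' : Fin n, ∑ α' : Fin n, ∑ β' : Fin n,
            (Rcoef q b a b' a' * Rcoef q β α β' α') • (z α' a' * star (z β' b')))
          + if a = b ∧ α = β then algebraMap ℂ A (1 - (q : ℂ) ^ 2) else 0) := by
  -- `G` is the right side of the mixed relation. Summing over the column indices with the
  -- R-coefficients reproduces it up to a scalar.
  set G : Fin n → Fin n → A := fun α' β' =>
    (if a = b then (q : ℂ) else 1) • (t (e α') (e a) * star (t (e β') (e b))) +
      (if a = b then ((q : ℂ) - (q : ℂ)⁻¹) •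
        ∑ j with b < j, t (e α') (e j) * star (t (e β') (e j)) else 0) with hG
  have hinner : ∀ α' β', ∑ a', ∑ b', Rcoef q b a b' a' • (z α' a' * star (z β' b')) =
      (q : ℂ)⁻¹ • (p α' * p β') • G α' β' := by
    intro α' β'
    rw [sum_Rcoef]
    simp only [hz, star_smul, hps, smul_mul_assoc, mul_smul_comm, hG, smul_smul, ← Finset.smul_sum]
    by_cases hab : a = b
    · subst hab
      simp only [if_true]
      match_scalars <;> field_simp
      ring
    · simp only [hab, if_false, add_zero]
      match_scalars
      field_simp
  have houter : (∑ a' : Fin n, ∑ b' : Fin n, ∑ α' : Fin n, ∑ β' : Fin n,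
            (Rcoef q b a b' a' * Rcoef q β α β' α') • (z α' a' * star (z β' b'))) =
      ∑ α', ∑ β', Rcoef q β α β' α' • ((q : ℂ)⁻¹ • (p α' * p β') • G α' β') := by
    simp only [← hinner, Finset.smul_sum, smul_smul]
    simp only [mul_comm (Rcoef q b a _ _)]
    rw [Finset.sum_comm_cycle]
    refine Finset.sum_congr rfl fun α' _ => ?_
    rw [Finset.sum_comm_cycle]
  rw [houter, sum_Rcoef]
  have hmixed := h.mixed hu (e β) (e b) (e α) (e a)
  simp only [he.injective.eq_iff, sum_lt_of_upper he hup] at hmixed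
  rw [hz, hz, star_smul, hps, smul_mul_assoc, mul_smul_comm]
  by_cases hαβ : α = β
  · subst hαβ
    simp only [if_true, and_true]
    -- For equal row indices the triangular system must be solved; extension by zero to ℕ lets its
    -- tails be sums over intervals.
    let X : ℕ → A := fun r => if hr : r < n then
      star (t (e ⟨r, hr⟩) (e b)) * t (e ⟨r, hr⟩) (e a) else 0
    let W : ℕ → A := fun r => if hr : r < n then G ⟨r, hr⟩ ⟨r, hr⟩ else 0
    have hX : ∀ r : Fin n, star (t (e r) (e b)) * t (e r) (e a) = X r := fun r => by simp [X]
    have hW : ∀ r : Fin n, G r r = W r := fun r => by simp [W]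
    have hrow : ∀ r < n, W r = (q : ℂ)⁻¹ • X r - ((q : ℂ) - (q : ℂ)⁻¹) •
        ∑ j ∈ Finset.Ico (r + 1) n, X j + ((q : ℂ) - (q : ℂ)⁻¹) • (if a = b then (1 : A) else 0) := by
      intro r hr
      have h1 := h.mixed_row hu (e ⟨r, hr⟩) (e b) (e a)
      simp only [he.injective.eq_iff, sum_lt_of_upper he hup, hX, sum_fin_lt] at h1
      have h2 : W r = G ⟨r, hr⟩ ⟨r, hr⟩ := (hW ⟨r, hr⟩).symm
      rw [h2]
      simp only [hG]
      rw [← h1]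
      congr 1
      split_ifs
      · rw [Algebra.algebraMap_eq_smul_one]
      · simp
    have key := solve_row hq X W p (if a = b then (1 : A) else 0) hn hp hrow α.2
    rw [smul_smul, ← pow_two, hX, key]
    simp only [hW, sum_fin_lt (fun j => (q : ℂ)⁻¹ • (p j * p j) • W j)]
    congr 1
    · simp only [← pow_two, ← Finset.smul_sum]
      match_scalars <;> field_simp
    · split_ifs
      · rw [Algebra.algebraMap_eq_smul_one]
      · simp
  -- For distinct row indices only one term of the outer R-sum survives, and the mixed relation
  -- applies directly.
  · have hβα : ¬ β = α := fun h => hαβ h.symm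
    simp only [hβα, if_false, add_zero, one_smul] at hmixed
    rw [if_neg hαβ, if_neg (fun hh => hαβ hh.2), add_zero, hmixed]
    simp only [hG]
    match_scalars <;> field_simp

end

/-! ### The elementary representations -/

section
variable {A : Type*} [Ring A] [Algebra ℂ A]

set_option maxHeartbeats 1600000 in
/-- A matrix that differs from the identity only in an adjacent `2 × 2` block satisfies the relations
of the algebra of quantum matrices as soon as the block does. -/
theorem rtt_of_adjacent_block {q : ℂ} (hq : q ≠ 0) {t : ℕ → ℕ → A} {s : ℕ} {w x y v : A}
    (hw : t s s = w) (hx : t s (s + 1) = x) (hy : t (s + 1) s = y) (hv : t (s + 1) (s + 1) = v)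
    (hl : ∀ a b, a ≠ s → a ≠ s + 1 → t a b = if a = b then 1 else 0)
    (hr : ∀ a b, b ≠ s → b ≠ s + 1 → t a b = if a = b then 1 else 0)
    (hwx : w * x = q • (x * w)) (hwy : w * y = q • (y * w)) (hxv : x * v = q • (v * x))
    (hyv : y * v = q • (v * y)) (hxy : x * y = y * x)
    (hwv : w * v = v * w + (q - q⁻¹) • (y * x)) (α β a b : ℕ) :
    (if α = β then q else 1) • (t β a * t α b) +
      (if α < β then q - q⁻¹ else 0) • (t α a * t β b) =
    (if a = b then q else 1) • (t α b * t β a) +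
      (if a < b then q - q⁻¹ else 0) • (t α a * t β b) := by
  have hs : ∀ x : ℕ, (x ≠ s ∧ x ≠ s + 1) ∨ x = s ∨ x = s + 1 := by omega
  -- An index outside the block compares in the same way with `s` and `s + 1`, so the order
  -- conditions agree for both in the 81 cases below.
  have hlt : ∀ x : ℕ, x ≠ s → x ≠ s + 1 → (x < s + 1 ↔ x < s) ∧ (s + 1 < x ↔ s < x) := by omega
  have hl1 : ∀ a, a ≠ s → a ≠ s + 1 → t a s = 0 ∧ t a (s + 1) = 0 ∧ t s a = 0 ∧ t (s + 1) a = 0 :=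
    fun a h h' => by simp [hl a _ h h', hr _ a h h', h, h', h.symm, h'.symm]
  rcases hs α with ⟨hα, hα'⟩ | hα | hα <;> rcases hs β with ⟨hβ, hβ'⟩ | hβ | hβ <;>
    rcases hs a with ⟨ha, ha'⟩ | ha | ha <;> rcases hs b with ⟨hb, hb'⟩ | hb | hb
  all_goals clear hs
  all_goals try simp [*]
  all_goals try (split_ifs <;> first | rfl | (exfalso; omega) | simp_all)
  all_goals first
    | (match_scalars <;> field_simp <;> ring)
    | (intros; omega)

theorem IsRTT.map {ι B : Type*} [Fintype ι] [LinearOrder ι] [Ring B] [Algebra ℂ B] {q : ℂ}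
    {t : Matrix ι ι A} (h : IsRTT q t) (f : A →ₐ[ℂ] B) : IsRTT q (t.map f) := by
  intro α β a b
  have := congrArg f (h α β a b)
  simpa only [map_add, map_smul, map_mul, Matrix.map_apply] using this

end

section
variable {A ι : Type*} [Ring A] [Algebra ℂ A] [StarRing A] [Fintype ι] [LinearOrder ι]

theorem IsUnitaryMatrix.map {B : Type*} [Ring B] [Algebra ℂ B] [StarRing B] {t : Matrix ι ι A}
    (h : IsUnitaryMatrix t) (f : A →⋆ₐ[ℂ] B) : IsUnitaryMatrix (t.map f) := by
  constructor <;> ext a b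
  · have := congrArg f (h.row_sum a b)
    simpa [Matrix.mul_apply, Matrix.one_apply, apply_ite f, ← map_star] using this
  · have := congrArg f (h.col_sum a b)
    simpa [Matrix.mul_apply, Matrix.one_apply, apply_ite f, ← map_star] using this

/-- Outside the block the matrix is the identity. Inside it three entries suffice, since the fourth
identity is the adjoint of `h2`. -/
theorem mul_star_of_block {t : Matrix ι ι A} {u v : ι} (huv : u ≠ v)
    (hl : ∀ a b, a ≠ u → a ≠ v → t a b = if a = b then 1 else 0)
    (hr : ∀ a b, b ≠ u → b ≠ v → t a b = if a = b then 1 else 0)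
    (h1 : t u u * star (t u u) + t u v * star (t u v) = 1)
    (h2 : t u u * star (t v u) + t u v * star (t v v) = 0)
    (h3 : t v u * star (t v u) + t v v * star (t v v) = 1) : t * star t = 1 := by
  have h2' : t v u * star (t u u) + t v v * star (t u v) = 0 := by
    simpa using congrArg star h2
  ext a b
  simp only [Matrix.mul_apply, Matrix.star_apply, Matrix.one_apply]
  by_cases ha : a ≠ u ∧ a ≠ v
  · simp only [hl a _ ha.1 ha.2, ite_mul, one_mul, zero_mul, Finset.sum_ite_eq, Finset.mem_univ,
      if_true, hr b a ha.1 ha.2]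
    rw [apply_ite star, star_one, star_zero, if_congr (eq_comm (a := b)) rfl rfl]
  by_cases hb : b ≠ u ∧ b ≠ v
  · simp only [hl b _ hb.1 hb.2, apply_ite star, star_one, star_zero, mul_ite, mul_one, mul_zero,
      Finset.sum_ite_eq, Finset.mem_univ, if_true, hr a b hb.1 hb.2]
  have hsum : ∑ c, t a c * star (t b c) = t a u * star (t b u) + t a v * star (t b v) := by
    refine Finset.sum_eq_add u v huv (fun c _ hc => ?_) (by simp) (by simp)
    have : a ≠ c := by rintro rfl; exact ha hc
    rw [hr a c hc.1 hc.2, if_neg this, zero_mul]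
  rw [hsum]
  have ha' : a = u ∨ a = v := by tauto
  have hb' : b = u ∨ b = v := by tauto
  rcases ha' with rfl | rfl <;> rcases hb' with rfl | rfl <;> simp [*, huv.symm]

end

/-! ### The matrix of each π_s is a unitary quantum matrix. -/

section
variable (q : ℝ) (h0 : 0 < q) (h1 : q < 1)

theorem piS_of_ne_left {s a b : ℕ} (ha : a ≠ s) (ha' : a ≠ s + 1) :
    piS q h0 h1 s a b = if a = b then 1 else 0 := by
  simp [piS, ha, ha']

theorem piS_of_ne_right {s a b : ℕ} (hb : b ≠ s) (hb' : b ≠ s + 1) :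
    piS q h0 h1 s a b = if a = b then 1 else 0 := by
  simp [piS, hb, hb']

theorem piS_self_self (s : ℕ) : piS q h0 h1 s s s = star (opA q h0) := by
  simp [piS, star_opA]

theorem piS_self_succ (s : ℕ) : piS q h0 h1 s s (s + 1) = (q : ℂ) • opD q h0 h1 := by
  simp [piS]

theorem piS_succ_self (s : ℕ) : piS q h0 h1 s (s + 1) s = -opD q h0 h1 := by
  simp [piS]

theorem piS_succ_succ (s : ℕ) : piS q h0 h1 s (s + 1) (s + 1) = opA q h0 := by
  simp [piS, opA]

/-- The matrix of the operators `π_s(t_{a,b})`. -/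
def piMat (M s : ℕ) : Matrix (Fin M) (Fin M) (L2 ℕ →L[ℂ] L2 ℕ) :=
  Matrix.of fun a b => piS q h0 h1 s ((a : ℕ) + 1) ((b : ℕ) + 1)

theorem piMat_apply (M s : ℕ) (a b : Fin M) :
    piMat q h0 h1 M s a b = piS q h0 h1 s ((a : ℕ) + 1) ((b : ℕ) + 1) := rfl

/-- The exchange relations contain no sums over indices, so they restrict from the infinite matrix
indexed by ℕ. Unitarity does involve such sums and therefore needs `1 ≤ s < M`, so that the whole
block fits. -/
theorem isRTT_piMat (M s : ℕ) : IsRTT (q : ℂ) (piMat q h0 h1 M s) := by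
  have hq : (q : ℂ) ≠ 0 := by exact_mod_cast h0.ne'
  intro α β a b
  have := rtt_of_adjacent_block hq (piS_self_self q h0 h1 s) (piS_self_succ q h0 h1 s)
    (piS_succ_self q h0 h1 s) (piS_succ_succ q h0 h1 s)
    (fun _ _ => piS_of_ne_left q h0 h1) (fun _ _ => piS_of_ne_right q h0 h1)
    (by rw [mul_smul_comm, smul_mul_assoc, star_opA_mul_opD q h0 h1])
    (by rw [mul_neg, neg_mul, smul_neg, star_opA_mul_opD q h0 h1])
    (by rw [mul_smul_comm, smul_mul_assoc, opD_mul_opA q h0 h1])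
    (by rw [mul_neg, neg_mul, smul_neg, opD_mul_opA q h0 h1])
    (by rw [mul_neg, neg_mul, smul_mul_assoc, mul_smul_comm])
    (by
      rw [star_mul_opA q h0 h1, opA_mul_star q h0 h1, mul_smul_comm, neg_mul]
      match_scalars <;> field_simp
      ring)
    ((α : ℕ) + 1) ((β : ℕ) + 1) ((a : ℕ) + 1) ((b : ℕ) + 1)
  simpa only [piMat_apply, Fin.lt_def, Fin.ext_iff, Nat.add_right_cancel_iff,
    Nat.add_lt_add_iff_right] using this

theorem isUnitaryMatrix_piMat {M s : ℕ} (hs : 1 ≤ s) (hM : s < M) :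
    IsUnitaryMatrix (piMat q h0 h1 M s) := by
  obtain ⟨s, rfl⟩ : ∃ r, s = r + 1 := ⟨s - 1, by omega⟩
  have e1 := opA_mul_star q h0 h1
  have e2 := star_mul_opA q h0 h1
  have e3 := opD_mul_opA q h0 h1
  have e4 := star_opA_mul_opD q h0 h1
  have e5 := star_opD q h0 h1
  let u : Fin M := ⟨s, by omega⟩
  let v : Fin M := ⟨s + 1, hM⟩
  have huv : u ≠ v := by simp [u, v]
  have huu : piMat q h0 h1 M (s + 1) u u = star (opA q h0) := piS_self_self q h0 h1 (s + 1)
  have huv' : piMat q h0 h1 M (s + 1) u v = (q : ℂ) • opD q h0 h1 := piS_self_succ q h0 h1 (s + 1)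
  have hvu : piMat q h0 h1 M (s + 1) v u = -opD q h0 h1 := piS_succ_self q h0 h1 (s + 1)
  have hvv : piMat q h0 h1 M (s + 1) v v = opA q h0 := piS_succ_succ q h0 h1 (s + 1)
  have hu : ∀ a : Fin M, a ≠ u → (a : ℕ) + 1 ≠ s + 1 := fun a h h' => h (Fin.ext (by simpa [u] using h'))
  have hv : ∀ a : Fin M, a ≠ v → (a : ℕ) + 1 ≠ s + 1 + 1 :=
    fun a h h' => h (Fin.ext (by simpa [v] using h'))
  have hl : ∀ a b, a ≠ u → a ≠ v → piMat q h0 h1 M (s + 1) a b = if a = b then 1 else 0 := by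
    intro a b ha hb
    rw [piMat_apply, piS_of_ne_left q h0 h1 (hu a ha) (hv a hb)]
    simp only [Nat.add_right_cancel_iff, Fin.ext_iff]
  have hr : ∀ a b, b ≠ u → b ≠ v → piMat q h0 h1 M (s + 1) a b = if a = b then 1 else 0 := by
    intro a b ha hb
    rw [piMat_apply, piS_of_ne_right q h0 h1 (hu b ha) (hv b hb)]
    simp only [Nat.add_right_cancel_iff, Fin.ext_iff]
  have hqs : star (q : ℂ) = q := Complex.conj_ofReal q
  have hq2 : ∀ x : L2 ℕ →L[ℂ] L2 ℕ, (q : ℂ) • (q : ℂ) • x = (q : ℂ) ^ 2 • x := fun x => by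
    rw [smul_smul, pow_two]
  constructor
  · refine mul_star_of_block huv hl hr ?_ ?_ ?_ <;> simp only [huu, huv', hvu, hvv, star_star,
      star_smul, star_neg, e5, hqs, mul_smul_comm, smul_mul_assoc, e1, e2, e4, mul_neg, neg_mul,
      neg_neg, hq2]
    · exact sub_add_cancel _ _
    · exact neg_add_cancel _
    · exact add_sub_cancel _ _
  -- The other half of unitarity is the same criterion for the adjoint matrix.
  · have := mul_star_of_block (t := star (piMat q h0 h1 M (s + 1))) huv
      (fun a b ha ha' => by
        rw [Matrix.star_apply, hr b a ha ha', apply_ite star, star_one, star_zero,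
          if_congr (eq_comm (a := b)) rfl rfl])
      (fun a b ha ha' => by
        rw [Matrix.star_apply, hl b a ha ha', apply_ite star, star_one, star_zero,
          if_congr (eq_comm (a := b)) rfl rfl])
    simp only [star_star] at this
    refine this ?_ ?_ ?_ <;> simp only [Matrix.star_apply, huu, huv', hvu, hvv, star_star,
      star_smul, star_neg, e5, hqs, mul_smul_comm, smul_mul_assoc, e1, e2, e3, mul_neg, neg_mul,
      neg_neg, hq2]
    · exact sub_add_cancel _ _
    · exact add_neg_cancel _
    · exact add_sub_cancel _ _

/-! ### Products of elementary representations -/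

variable {N : ℕ} (σ : Fin N → ℕ)

/-- The operators on a single tensor factor, as a `*`-homomorphism. -/
def siteStarHom (m : Fin N) :
    (L2 ℕ →L[ℂ] L2 ℕ) →⋆ₐ[ℂ] (L2 (Fin N → ℕ) →L[ℂ] L2 (Fin N → ℕ)) :=
  { siteHom m with map_star' := site_star m }

/-- The matrix of the operators `π_{σ m}(t_{a,b})` acting on the `m`-th tensor factor. -/
def siteMat (M : ℕ) (m : Fin N) :
    Matrix (Fin M) (Fin M) (L2 (Fin N → ℕ) →L[ℂ] L2 (Fin N → ℕ)) :=
  (piMat q h0 h1 M (σ m)).map (siteStarHom m)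

theorem siteMat_apply (M : ℕ) (m : Fin N) (a b : Fin M) : siteMat q h0 h1 σ M m a b =
    site m (piS q h0 h1 (σ m) ((a : ℕ) + 1) ((b : ℕ) + 1)) := rfl

/-- The product of the matrices `siteMat` along a list of positions. -/
def wordMat (M : ℕ) (l : List (Fin N)) :
    Matrix (Fin M) (Fin M) (L2 (Fin N → ℕ) →L[ℂ] L2 (Fin N → ℕ)) :=
  (l.map (siteMat q h0 h1 σ M)).prod

theorem wordMat_cons (M : ℕ) (m : Fin N) (l : List (Fin N)) : wordMat q h0 h1 σ M (m :: l) =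
    siteMat q h0 h1 σ M m * wordMat q h0 h1 σ M l := by
  simp [wordMat]

theorem site_commute_wordMat (M : ℕ) {m : Fin N} {l : List (Fin N)} (h : m ∉ l)
    (B : L2 ℕ →L[ℂ] L2 ℕ) (a b : Fin M) :
    Commute (site m B) (wordMat q h0 h1 σ M l a b) := by
  induction l generalizing a b with
  | nil =>
    rw [wordMat, List.map_nil, List.prod_nil, Matrix.one_apply]
    split_ifs
    · exact Commute.one_right _
    · exact Commute.zero_right _
  | cons i l ih =>
    rw [List.mem_cons, not_or] at h
    rw [wordMat_cons, Matrix.mul_apply]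
    exact Commute.sum_right _ _ _ fun c _ => (site_commute h.1 _ _).mul_right (ih h.2 c b)

/-- Distinct positions are needed for the entries of the factors to commute; unitarity below needs
no such condition. -/
theorem isRTT_wordMat (M : ℕ) {l : List (Fin N)} (hl : l.Nodup) :
    IsRTT (q : ℂ) (wordMat q h0 h1 σ M l) := by
  induction l with
  | nil => exact IsRTT.one _
  | cons m l ih =>
    rw [List.nodup_cons] at hl
    rw [wordMat_cons]
    exact ((isRTT_piMat q h0 h1 M (σ m)).map (siteStarHom m).toAlgHom).mul (ih hl.2)
      fun a b c d => site_commute_wordMat q h0 h1 σ M hl.1 _ c d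

theorem isUnitaryMatrix_wordMat {M : ℕ} (hσ : ∀ m, 1 ≤ σ m ∧ σ m < M) (l : List (Fin N)) :
    IsUnitaryMatrix (wordMat q h0 h1 σ M l) := by
  induction l with
  | nil => exact IsUnitaryMatrix.one
  | cons m l ih =>
    rw [wordMat_cons]
    exact ((isUnitaryMatrix_piMat q h0 h1 (hσ m).1 (hσ m).2).map (siteStarHom m)).mul ih

theorem prod_ofFn_apply {M : ℕ} {A : Type*} [Ring A] {N : ℕ}
    (T : Fin N → Matrix (Fin M) (Fin M) A) (i j : Fin M) :
    (List.ofFn T).prod i j = ∑ k : Fin (N + 1) → Fin M, if k 0 = i ∧ k (Fin.last N) = j then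
      (List.ofFn fun m : Fin N => T m (k m.castSucc) (k m.succ)).prod else 0 := by
  induction N generalizing i with
  | zero =>
    rw [← (Equiv.funUnique (Fin 1) (Fin M)).symm.sum_comp]
    simp [Matrix.one_apply, ite_and]
  | succ N ih =>
    rw [List.ofFn_succ, List.prod_cons, Matrix.mul_apply]
    simp only [ih, Finset.mul_sum]
    -- A path is split into head and tail. The head is forced to be `i`, and the summation index of
    -- the matrix product is forced to be the first entry of the tail.
    rw [Finset.sum_comm, ← (Fin.consEquiv fun _ : Fin (N + 2) => Fin M).sum_comp,
      Fintype.sum_prod_type]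
    symm
    rw [Finset.sum_eq_single i]
    · refine Finset.sum_congr rfl fun k _ => ?_
      symm
      rw [Finset.sum_eq_single (k 0)]
      · simp [Fin.consEquiv, List.ofFn_succ, ← Fin.succ_last]
      · intro b _ hb
        simp [hb.symm]
      · simp
    · intro b _ hb
      simp [Fin.consEquiv, hb]
    · simp

theorem piWord_eq_wordMat (M : ℕ) (a b : Fin M) :
    piWord q h0 h1 M σ ((a : ℕ) + 1) ((b : ℕ) + 1) =
      wordMat q h0 h1 σ M (List.finRange N) a b := by
  rw [wordMat, ← List.ofFn_eq_map, prod_ofFn_apply, piWord]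
  simp only [Nat.add_right_cancel_iff, ← Fin.ext_iff, tensorOp, ← List.ofFn_eq_map, siteMat_apply]

theorem wordMat_drop {M : ℕ} {m : ℕ} (hm : m < N) :
    wordMat q h0 h1 σ M ((List.finRange N).drop m) = siteMat q h0 h1 σ M ⟨m, hm⟩ *
      wordMat q h0 h1 σ M ((List.finRange N).drop (m + 1)) := by
  rw [List.drop_eq_getElem_cons (by simpa using hm), wordMat_cons]
  simp

theorem notMem_drop_succ {m : ℕ} (hm : m < N) :
    (⟨m, hm⟩ : Fin N) ∉ (List.finRange N).drop (m + 1) := by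
  have h := (List.nodup_finRange N).sublist (List.drop_sublist m _)
  rw [List.drop_eq_getElem_cons (by simpa using hm), List.nodup_cons] at h
  simpa using h.1

end

/-! ### Suffixes of the word -/

/-- The basis vector `e_{f 0} ⊗ ⋯ ⊗ e_{f (N-1)}`. -/
abbrev basisVec {N : ℕ} (f : Fin N → ℕ) : L2 (Fin N → ℕ) := lp.single 2 f (1 : ℂ)

section
variable {N : ℕ}

theorem site_smul (m : Fin N) (c : ℂ) (B : L2 ℕ →L[ℂ] L2 ℕ) : site m (c • B) = c • site m B :=
  map_smul (siteHom m) c B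

theorem site_neg (m : Fin N) (B : L2 ℕ →L[ℂ] L2 ℕ) : site m (-B) = -site m B :=
  map_neg (siteHom m) B

theorem clm_mul_apply {E : Type*} [NormedAddCommGroup E] [NormedSpace ℂ E] (S T : E →L[ℂ] E)
    (x : E) : (S * T) x = S (T x) := rfl

theorem clm_sub_apply {E : Type*} [NormedAddCommGroup E] [NormedSpace ℂ E] (S T : E →L[ℂ] E)
    (x : E) : (S - T) x = S x - T x := rfl

theorem site_basisVec_eq_zero (m : Fin N) {B : L2 ℕ →L[ℂ] L2 ℕ} {f : Fin N → ℕ}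
    (h : B (lp.single 2 (f m) (1 : ℂ)) = 0) : site m B (basisVec f) = 0 := by
  rw [site_single_of_apply m (c := 0) (k := 0) (by rw [h, zero_smul]), zero_smul]

variable (q : ℝ) (h0 : 0 < q) (h1 : q < 1)

theorem site_opD_basisVec (m : Fin N) (f : Fin N → ℕ) :
    site m (opD q h0 h1) (basisVec f) = (q : ℂ) ^ f m • basisVec f := by
  rw [site_single_of_apply m (opD_single q h0 h1 _), Function.update_eq_self]

theorem site_star_opA_basisVec (m : Fin N) {f : Fin N → ℕ} (hf : f m = 0) :
    site m (star (opA q h0)) (basisVec f) = 0 :=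
  site_basisVec_eq_zero m (by rw [hf, star_opA_single_zero])

theorem site_opA_basisVec (m : Fin N) (f : Fin N → ℕ) :
    site m (opA q h0) (basisVec f) = ((Real.sqrt (1 - q ^ (2 * (f m + 1))) : ℝ) : ℂ) •
      basisVec (Function.update f m (f m + 1)) :=
  site_single_of_apply m (opA_single q h0 _)

variable (σ : Fin N → ℕ) {M : ℕ}

/-- The operator assigned to `t_{a+1,b+1}` by the part of the word `σ` that starts at the position
`m`. -/
def suffixOp (m a : ℕ) (b : Fin M) : L2 (Fin N → ℕ) →L[ℂ] L2 (Fin N → ℕ) :=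
  if h : a < M then wordMat q h0 h1 σ M ((List.finRange N).drop m) ⟨a, h⟩ b else 0

theorem suffixOp_end {a : ℕ} {b : Fin M} :
    suffixOp q h0 h1 σ N a b = if a = (b : ℕ) then 1 else 0 := by
  unfold suffixOp
  split_ifs with h h' h'
  · subst h'
    rw [List.drop_of_length_le (by simp), wordMat, List.map_nil, List.prod_nil, Matrix.one_apply,
      if_pos rfl]
  · rw [List.drop_of_length_le (by simp), wordMat, List.map_nil, List.prod_nil, Matrix.one_apply,
      if_neg fun h2 => h' (congrArg Fin.val h2)]
  · exact absurd (h' ▸ b.2) h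
  · rfl

theorem site_commute_suffixOp {m : ℕ} (hm : m < N) (B : L2 ℕ →L[ℂ] L2 ℕ) (a : ℕ) (b : Fin M) :
    Commute (site ⟨m, hm⟩ B) (suffixOp q h0 h1 σ (m + 1) a b) := by
  unfold suffixOp
  split_ifs
  · exact site_commute_wordMat q h0 h1 σ M (notMem_drop_succ hm) _ _ _
  · exact Commute.zero_right _

/-- Levels count from 0 and letters from 1, so the letter s mixes exactly the levels s - 1 and s. -/
theorem suffixOp_of_ne {m : ℕ} (hm : m < N) {a : ℕ} (b : Fin M) (ha : a + 1 ≠ σ ⟨m, hm⟩)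
    (ha' : a ≠ σ ⟨m, hm⟩) : suffixOp q h0 h1 σ m a b = suffixOp q h0 h1 σ (m + 1) a b := by
  unfold suffixOp
  split_ifs with h
  · rw [wordMat_drop q h0 h1 σ hm, Matrix.mul_apply, Finset.sum_eq_single ⟨a, h⟩]
    · rw [siteMat_apply, piS_of_ne_left q h0 h1 ha (by simpa using ha'), if_pos rfl, site_one,
        one_mul]
    · intro c _ hc
      have : a + 1 ≠ (c : ℕ) + 1 := fun h => hc (Fin.ext (by simpa using h.symm))
      rw [siteMat_apply, piS_of_ne_left q h0 h1 ha (by simpa using ha'), if_neg this,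
        ← siteHom_apply, map_zero, zero_mul]
    · simp
  · rfl

theorem suffixOp_mid {m : ℕ} (hm : m < N) {a : ℕ} (b : Fin M) (hM : a + 1 < M)
    (hσ : σ ⟨m, hm⟩ = a + 1) (x : ℕ) (hx : x = a ∨ x = a + 1) :
    suffixOp q h0 h1 σ m x b =
      site ⟨m, hm⟩ (piS q h0 h1 (a + 1) (x + 1) (a + 1)) * suffixOp q h0 h1 σ (m + 1) a b +
      site ⟨m, hm⟩ (piS q h0 h1 (a + 1) (x + 1) (a + 2)) *
        suffixOp q h0 h1 σ (m + 1) (a + 1) b := by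
  unfold suffixOp
  rw [dif_pos (show x < M by omega), dif_pos (show a < M by omega), dif_pos hM,
    wordMat_drop q h0 h1 σ hm, Matrix.mul_apply]
  rw [Finset.sum_eq_add (⟨a, by omega⟩ : Fin M) ⟨a + 1, hM⟩ (by simp) _ (by simp) (by simp)]
  · simp only [siteMat_apply, hσ]
  · intro c _ hc
    have hc1 : (c : ℕ) ≠ a := fun h => hc.1 (Fin.ext h)
    have hc2 : (c : ℕ) ≠ a + 1 := fun h => hc.2 (Fin.ext h)
    have hxc : ¬ (x + 1 = (c : ℕ) + 1) := by omega
    rw [siteMat_apply, hσ, piS_of_ne_right q h0 h1 (by omega) (by omega)]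
    simp only [hxc, if_false, ← siteHom_apply, map_zero, zero_mul]

theorem suffixOp_low {m : ℕ} (hm : m < N) {a : ℕ} (b : Fin M) (hM : a + 1 < M)
    (hσ : σ ⟨m, hm⟩ = a + 1) : suffixOp q h0 h1 σ m a b =
      site ⟨m, hm⟩ (star (opA q h0)) * suffixOp q h0 h1 σ (m + 1) a b +
      (q : ℂ) • (site ⟨m, hm⟩ (opD q h0 h1) * suffixOp q h0 h1 σ (m + 1) (a + 1) b) := by
  rw [suffixOp_mid q h0 h1 σ hm b hM hσ a (Or.inl rfl), piS_self_self, piS_self_succ,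
    site_smul, smul_mul_assoc]

theorem suffixOp_high {m : ℕ} (hm : m < N) {a : ℕ} (b : Fin M) (hM : a + 1 < M)
    (hσ : σ ⟨m, hm⟩ = a + 1) : suffixOp q h0 h1 σ m (a + 1) b =
      site ⟨m, hm⟩ (opA q h0) * suffixOp q h0 h1 σ (m + 1) (a + 1) b -
      site ⟨m, hm⟩ (opD q h0 h1) * suffixOp q h0 h1 σ (m + 1) a b := by
  rw [suffixOp_mid q h0 h1 σ hm b hM hσ (a + 1) (Or.inr rfl), piS_succ_self, piS_succ_succ,
    site_neg, neg_mul, neg_add_eq_sub]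

/-- On a vector whose tensor factors from the position `m` on are `e_0`. -/
theorem suffixOp_low_apply {m : ℕ} (hm : m < N) {a : ℕ} (b : Fin M) (hM : a + 1 < M)
    (hσ : σ ⟨m, hm⟩ = a + 1) {f : Fin N → ℕ} (hf : f ⟨m, hm⟩ = 0) :
    suffixOp q h0 h1 σ m a b (basisVec f) =
      (q : ℂ) • suffixOp q h0 h1 σ (m + 1) (a + 1) b (basisVec f) := by
  -- The one-site operators commute with the later part of the word, so they may act on the basis
  -- vector itself, where the annihilator gives zero and d(q) gives 1.
  rw [suffixOp_low q h0 h1 σ hm b hM hσ, (site_commute_suffixOp q h0 h1 σ hm _ a b).eq,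
    (site_commute_suffixOp q h0 h1 σ hm _ (a + 1) b).eq]
  change suffixOp q h0 h1 σ (m + 1) a b (site ⟨m, hm⟩ (star (opA q h0)) (basisVec f)) +
    (q : ℂ) • suffixOp q h0 h1 σ (m + 1) (a + 1) b (site ⟨m, hm⟩ (opD q h0 h1) (basisVec f)) = _
  rw [site_star_opA_basisVec q h0 _ hf, site_opD_basisVec, hf, pow_zero, one_smul, map_zero,
    zero_add]

theorem suffixOp_untouched {m m' : ℕ} (hmm : m ≤ m') (hm' : m' ≤ N) {a : ℕ} (b : Fin M)
    (h : ∀ k (hk : k < N), m ≤ k → k < m' → a + 1 ≠ σ ⟨k, hk⟩ ∧ a ≠ σ ⟨k, hk⟩) :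
    suffixOp q h0 h1 σ m a b = suffixOp q h0 h1 σ m' a b := by
  induction hmm using Nat.decreasingInduction with
  | self => rfl
  | of_succ k hk ih =>
    have hkN : k < N := by omega
    obtain ⟨h2, h3⟩ := h k hkN le_rfl hk
    rw [suffixOp_of_ne q h0 h1 σ hkN b h2 h3]
    exact ih fun l hl hl1 hl2 => h l hl (by omega) hl2

end

/-! ### The action of the operators `𝒯(z_j^i)` on basis vectors -/

section
variable (n : ℕ) (q : ℝ) (h0 : 0 < q) (h1 : q < 1)

theorem fockWord_apply {c r : ℕ} (hr : r < n) (h : n * c + r < n ^ 2) :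
    fockWord n ⟨n * c + r, h⟩ = c + n - r := by
  have hn : 0 < n := by omega
  simp only [fockWord]
  rw [Nat.mul_add_div hn, Nat.div_eq_of_lt hr, add_zero, Nat.mul_add_mod, Nat.mod_eq_of_lt hr]

theorem exists_block {k : ℕ} (hk : k < n ^ 2) : ∃ c r, c < n ∧ r < n ∧ k = n * c + r := by
  have hn : 0 < n := by
    rcases Nat.eq_zero_or_pos n with rfl | h
    · simp at hk
    · exact h
  refine ⟨k / n, k % n, ?_, Nat.mod_lt _ hn, (Nat.div_add_mod k n).symm⟩
  rw [Nat.div_lt_iff_lt_mul hn, ← pow_two]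
  exact hk

theorem fockWord_bounds (k : Fin (n ^ 2)) : 1 ≤ fockWord n k ∧ fockWord n k < 2 * n := by
  obtain ⟨c, r, hc, hr, hk⟩ := exists_block n k.2
  have : fockWord n k = c + n - r := by
    rw [← fockWord_apply n hr (hk ▸ k.2)]
    congr 1
    exact Fin.ext hk
  omega

theorem block_index_lt {c r : ℕ} (hc : c < n) (hr : r < n) : n * c + r < n ^ 2 := by nlinarith

/-- The part of the word from a position in the block `c` on, for a level that no letter between
that position and a later one moves. -/
theorem fockSuffix_untouched {m m' : ℕ} (hmm : m ≤ m') (hm' : m' ≤ n ^ 2) {a : ℕ}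
    (b : Fin (2 * n))
    (h : ∀ c r, c < n → r < n → m ≤ n * c + r → n * c + r < m' → a + 1 ≠ c + n - r ∧ a ≠ c + n - r) :
    suffixOp q h0 h1 (fockWord n) m a b = suffixOp q h0 h1 (fockWord n) m' a b := by
  refine suffixOp_untouched q h0 h1 (fockWord n) hmm hm' b fun k hk h2 h3 => ?_
  obtain ⟨c, r, hc, hr, rfl⟩ := exists_block n hk
  rw [fockWord_apply n hr]
  exact h c r hc hr h2 h3

theorem lt_of_block_lt {c r c' r' : ℕ} (hr : r' < n) (h : n * c + r ≤ n * c' + r') :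
    c ≤ c' ∧ (c = c' → r ≤ r') := by
  constructor
  · by_contra hc
    have : n * (c' + 1) ≤ n * c := Nat.mul_le_mul_left n (by omega)
    rw [Nat.mul_succ] at this
    omega
  · rintro rfl; omega

/-- The blocks from `c` on move only levels at least `c`, so the level `a` stays below `n` and never
reaches `b`. -/
theorem fockSuffix_small {c a : ℕ} (hc : c ≤ n) (ha : a < c) (b : Fin (2 * n))
    (hb : n ≤ (b : ℕ)) : suffixOp q h0 h1 (fockWord n) (n * c) a b = 0 := by
  have hcn : n * c ≤ n ^ 2 := by nlinarith
  rw [fockSuffix_untouched n q h0 h1 hcn le_rfl b, suffixOp_end, if_neg (by omega)]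
  intro c' r' hc' hr' h _
  have := (lt_of_block_lt n (r := 0) hr' (by omega)).1
  omega

/-- The letters of block `c` descend from c + n to c + 1. In the vacuum the letter a + 1 sends the
level `a` to a + 1 with a factor q, and the later, smaller letters leave a + 1 alone. -/
theorem fockSuffix_block {c a : ℕ} (hc : c < n) (ha : c ≤ a) (ha' : a < c + n) (b : Fin (2 * n))
    {f : Fin (n ^ 2) → ℕ} (hf : ∀ m : Fin (n ^ 2), n * c ≤ m → f m = 0) :
    suffixOp q h0 h1 (fockWord n) (n * c) a b (basisVec f) =
      (q : ℂ) • suffixOp q h0 h1 (fockWord n) (n * (c + 1)) (a + 1) b (basisVec f) := by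
  obtain ⟨r, hr⟩ : ∃ r, a + r + 1 = c + n := ⟨c + n - a - 1, by omega⟩
  have hrn : r < n := by omega
  have hlt := block_index_lt n hc hrn
  have hc1 : n * (c + 1) ≤ n ^ 2 := by nlinarith
  have hmul : n * (c + 1) = n * c + n := Nat.mul_succ _ _
  rw [fockSuffix_untouched n q h0 h1 (m' := n * c + r) (by omega) hlt.le b,
    suffixOp_low_apply q h0 h1 (fockWord n) hlt b (by omega)
      (by rw [fockWord_apply n hrn]; omega) (hf _ (by simp)),
    fockSuffix_untouched n q h0 h1 (m' := n * (c + 1)) (by omega) hc1 b]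
  · intro c' r' hc' hr' h2 h3
    have e1 := lt_of_block_lt n (r := r + 1) hr' (by omega)
    have e2 : c' < c + 1 := by
      by_contra h
      have : n * (c + 1) ≤ n * c' := Nat.mul_le_mul_left n (by omega)
      omega
    have e3 : c = c' := by omega
    subst e3
    omega
  · intro c' r' hc' hr' h2 h3
    have e1 := lt_of_block_lt n (r := 0) hr' (by omega)
    have e2 := lt_of_block_lt n hrn h3.le
    have e3 : c = c' := by omega
    subst e3
    omega

/-- Each of the remaining n - c blocks raises the level by one and contributes a factor q. -/
theorem fockSuffix_apply {c a : ℕ} (hc : c ≤ n) (ha : c ≤ a) (ha' : a < c + n) (b : Fin (2 * n))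
    {f : Fin (n ^ 2) → ℕ} (hf : ∀ m : Fin (n ^ 2), n * c ≤ m → f m = 0) :
    suffixOp q h0 h1 (fockWord n) (n * c) a b (basisVec f) =
      if a + n = b + c then (q : ℂ) ^ (n - c) • basisVec f else 0 := by
  induction hc using Nat.decreasingInduction generalizing a with
  | self =>
    rw [← pow_two, suffixOp_end]
    simp only [Nat.add_right_cancel_iff]
    split_ifs <;> simp
  | of_succ c hc ih =>
    have hmul : n * (c + 1) = n * c + n := Nat.mul_succ _ _
    rw [fockSuffix_block n q h0 h1 hc ha ha' b hf,
      ih (by omega) (by omega) fun m hm => hf m (by omega)]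
    have : a + 1 + n = b + (c + 1) ↔ a + n = b + c := by omega
    simp only [this]
    split_ifs
    · rw [smul_smul, ← pow_succ', show n - (c + 1) + 1 = n - c by omega]
    · rw [smul_zero]

/-- The recursion along the block `i` for the level that enters it from above. -/
theorem fockSuffix_enter {i r : ℕ} (hi : i < n) (hr : r < n) (b : Fin (2 * n)) :
    suffixOp q h0 h1 (fockWord n) (n * i + r) (n + i - r) b =
      site ⟨n * i + r, block_index_lt n hi hr⟩ (opA q h0) *
        suffixOp q h0 h1 (fockWord n) (n * (i + 1)) (n + i - r) b -
      site ⟨n * i + r, block_index_lt n hi hr⟩ (opD q h0 h1) *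
        suffixOp q h0 h1 (fockWord n) (n * i + (r + 1)) (n + i - (r + 1)) b := by
  obtain ⟨a, ha⟩ : ∃ a, n + i - r = a + 1 := ⟨n + i - r - 1, by omega⟩
  have hmul : n * (i + 1) = n * i + n := Nat.mul_succ _ _
  have hi1 : n * (i + 1) ≤ n ^ 2 := by nlinarith
  rw [ha, suffixOp_high q h0 h1 (fockWord n) (block_index_lt n hi hr) b (by omega)
    (by rw [fockWord_apply n hr]; omega), show n + i - (r + 1) = a by omega,
    fockSuffix_untouched n q h0 h1 (m := n * i + r + 1) (m' := n * (i + 1)) (a := a + 1)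
      (by omega) hi1 b]
  · rfl
  · intro c' r' hc' hr' h2 h3
    have e1 := lt_of_block_lt n (r := r + 1) hr' (by omega)
    have e2 : c' < i + 1 := by
      by_contra h
      have : n * (i + 1) ≤ n * c' := Nat.mul_le_mul_left n (by omega)
      omega
    have e3 : i = c' := by omega
    subst e3
    omega

/-- The blocks before `i` move only levels below n + i. -/
theorem fockSuffix_start {i : ℕ} (hi : i < n) (b : Fin (2 * n)) :
    suffixOp q h0 h1 (fockWord n) 0 (n + i) b =
      suffixOp q h0 h1 (fockWord n) (n * i) (n + i) b := by
  refine fockSuffix_untouched n q h0 h1 (by omega) (by nlinarith) b fun c r hc hr _ h => ?_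
  have : c < i := by
    by_contra hci
    have : n * i ≤ n * c := Nat.mul_le_mul_left n (by omega)
    omega
  omega

/-- Of the two terms of `fockSuffix_enter`, the adjoint of the first annihilates e_0 at its site,
and the second passes to the next letter. After the last letter of the block the level is `i` and
the suffix vanishes. -/
theorem star_fockSuffix_apply_zero {i : ℕ} (hi : i < n) {r : ℕ} (hr : r ≤ n) (b : Fin (2 * n))
    (hb : n ≤ (b : ℕ)) :
    star (suffixOp q h0 h1 (fockWord n) (n * i + r) (n + i - r) b) (basisVec 0) = 0 := by
  induction hr using Nat.decreasingInduction with
  | self =>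
    rw [← Nat.mul_succ, fockSuffix_small n q h0 h1 hi (by omega) b hb, star_zero]
    rfl
  | of_succ r hr ih =>
    rw [fockSuffix_enter n q h0 h1 hi hr b, star_sub, star_mul, star_mul, ← site_star, ← site_star,
      star_opD]
    rw [clm_sub_apply, clm_mul_apply, clm_mul_apply, site_star_opA_basisVec q h0 _ rfl, site_opD_basisVec]
    simp only [Pi.zero_apply, pow_zero, one_smul]
    rw [ih, map_zero, sub_zero]

/-- Leaving the descent at place `r` leads to the final level 2n - 1 - r. For n ≤ r + j this is
below n + j, and it only decreases further along the block. -/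
theorem fockSuffix_enter_eq_zero {i j : ℕ} (hi : i < n) {r : ℕ} (hr : r ≤ n) (b : Fin (2 * n))
    (hb : (b : ℕ) = n + j) (hrj : n ≤ r + j) {f : Fin (n ^ 2) → ℕ}
    (hf : ∀ m : Fin (n ^ 2), n * (i + 1) ≤ m → f m = 0) :
    suffixOp q h0 h1 (fockWord n) (n * i + r) (n + i - r) b (basisVec f) = 0 := by
  induction hr using Nat.decreasingInduction with
  | self =>
    rw [← Nat.mul_succ, fockSuffix_small n q h0 h1 hi (by omega) b (by omega)]
    rfl
  | of_succ r hr ih =>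
    rw [fockSuffix_enter n q h0 h1 hi hr b]
    rw [clm_sub_apply, clm_mul_apply, clm_mul_apply, ih (by omega), fockSuffix_apply n q h0 h1 hi (by omega) (by omega) b hf,
      if_neg (by omega), map_zero, map_zero, sub_zero]

/-- The level n + j is reached only by leaving the descent at place s = n - 1 - j, where C_q S acts.
The earlier places contribute -d(q), a nonzero scalar on basis vectors. -/
theorem fockSuffix_create {i j : ℕ} (hi : i < n) {r s : ℕ} (hs : s < n) (hsj : s + j + 1 = n)
    (hr : r ≤ s) (b : Fin (2 * n)) (hb : (b : ℕ) = n + j) {f : Fin (n ^ 2) → ℕ}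
    (hf : ∀ m : Fin (n ^ 2), n * (i + 1) ≤ m → f m = 0) : ∃ c : ℂ, c ≠ 0 ∧
    suffixOp q h0 h1 (fockWord n) (n * i + r) (n + i - r) b (basisVec f) =
      c • basisVec (Function.update f ⟨n * i + s, block_index_lt n hi hs⟩
        (f ⟨n * i + s, block_index_lt n hi hs⟩ + 1)) := by
  have hq : (q : ℂ) ≠ 0 := by exact_mod_cast h0.ne'
  induction hr using Nat.decreasingInduction with
  | self =>
    rw [fockSuffix_enter n q h0 h1 hi hs b]
    refine ⟨(q : ℂ) ^ (n - (i + 1)) * ((Real.sqrt (1 - q ^ (2 *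
      (f ⟨n * i + s, block_index_lt n hi hs⟩ + 1))) : ℝ) : ℂ), mul_ne_zero (pow_ne_zero _ hq) ?_, ?_⟩
    · rw [Complex.ofReal_ne_zero, Real.sqrt_ne_zero', sub_pos]
      exact pow_lt_one₀ h0.le h1 (by omega)
    · rw [clm_sub_apply, clm_mul_apply, clm_mul_apply, fockSuffix_enter_eq_zero n q h0 h1 hi (by omega) b hb (by omega) hf,
        fockSuffix_apply n q h0 h1 hi (by omega) (by omega) b hf, if_pos (by omega), map_zero,
        sub_zero, map_smul, site_opA_basisVec, smul_smul]
  | of_succ r hr ih =>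
    obtain ⟨c, hc, h⟩ := ih
    have hrn : r < n := by omega
    rw [fockSuffix_enter n q h0 h1 hi hrn b]
    rw [clm_sub_apply, clm_mul_apply, clm_mul_apply, h, fockSuffix_apply n q h0 h1 hi (by omega) (by omega) b hf, if_neg (by omega), map_zero,
      zero_sub, map_smul, site_opD_basisVec, smul_smul, ← neg_smul]
    exact ⟨_, neg_ne_zero.2 (mul_ne_zero hc (pow_ne_zero _ hq)), rfl⟩

/-- The index `n + j` in `Fin (2 * n)`. -/
def lowerRight (j : Fin n) : Fin (2 * n) := ⟨n + j, by omega⟩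

theorem fockOp_eq_wordMat (i j : Fin n) : fockOp n q h0 h1 i j =
    ((q : ℂ) ^ (((i : ℕ) + 1 : ℤ) - (n : ℤ))) • wordMat q h0 h1 (fockWord n) (2 * n)
      (List.finRange (n ^ 2)) (lowerRight n i) (lowerRight n j) := by
  rw [fockOp, ← piWord_eq_wordMat]
  rfl

theorem fockOp_eq_suffixOp (i j : Fin n) : fockOp n q h0 h1 i j =
    ((q : ℂ) ^ (((i : ℕ) + 1 : ℤ) - (n : ℤ))) •
      suffixOp q h0 h1 (fockWord n) (n * i) (n + i) (lowerRight n j) := by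
  rw [fockOp_eq_wordMat, ← fockSuffix_start n q h0 h1 i.2, suffixOp, dif_pos (by omega),
    List.drop_zero]
  rfl

theorem star_fockOp_vacuum (i j : Fin n) : star (fockOp n q h0 h1 i j) (basisVec 0) = 0 := by
  rw [fockOp_eq_suffixOp, star_smul]
  have := star_fockSuffix_apply_zero n q h0 h1 i.2 (Nat.zero_le n) (lowerRight n j)
    (Nat.le_add_right n j)
  change star ((q : ℂ) ^ (((i : ℕ) + 1 : ℤ) - (n : ℤ))) • star (suffixOp q h0 h1 (fockWord n) (n * i) (n + i) (lowerRight n j)) _ = _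
  rw [add_zero, Nat.sub_zero] at this
  rw [this, smul_zero]

/-- The operator `𝒯(z_j^i)` creates at a single position, if the later blocks are in the vacuum
state. -/
theorem fockOp_create {i s : ℕ} (hi : i < n) (hs : s < n) {f : Fin (n ^ 2) → ℕ}
    (hf : ∀ m : Fin (n ^ 2), n * (i + 1) ≤ m → f m = 0) : ∃ c : ℂ, c ≠ 0 ∧ ∃ j : Fin n,
    fockOp n q h0 h1 ⟨i, hi⟩ j (basisVec f) =
      c • basisVec (Function.update f ⟨n * i + s, block_index_lt n hi hs⟩
        (f ⟨n * i + s, block_index_lt n hi hs⟩ + 1)) := by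
  have hq : (q : ℂ) ≠ 0 := by exact_mod_cast h0.ne'
  obtain ⟨c, hc, h⟩ := fockSuffix_create n q h0 h1 hi hs (j := n - 1 - s) (by omega) (Nat.zero_le s)
    (lowerRight n ⟨n - 1 - s, by omega⟩) rfl hf
  refine ⟨_ * c, mul_ne_zero (zpow_ne_zero (((i : ℕ) + 1 : ℤ) - (n : ℤ)) hq) hc,
    ⟨n - 1 - s, by omega⟩, ?_⟩
  rw [fockOp_eq_suffixOp, mul_smul, ← h]
  rfl

/-- The basis vectors are obtained from the vacuum by the operators `𝒯(z_j^i)`. -/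
theorem basisVec_mem (V : Submodule ℂ (L2 (Fin (n ^ 2) → ℕ))) (hV : basisVec 0 ∈ V)
    (h : ∀ i j, ∀ x ∈ V, fockOp n q h0 h1 i j x ∈ V) (f : Fin (n ^ 2) → ℕ) : basisVec f ∈ V := by
  induction hk : ∑ m, f m generalizing f with
  | zero =>
    have : f = 0 := funext fun m => by simpa using (Finset.sum_eq_zero_iff.1 hk) m (by simp)
    rwa [this]
  | succ k ih =>
    have hne : (Finset.univ.filter fun m => f m ≠ 0).Nonempty := by
      by_contra hne
      rw [Finset.not_nonempty_iff_eq_empty, Finset.filter_eq_empty_iff] at hne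
      have : ∑ m, f m = 0 := Finset.sum_eq_zero fun m hm => by simpa using hne hm
      omega
    -- The last occupied position is lowered by one. All later blocks are then empty, as
    -- `fockOp_create` requires to raise it again.
    obtain ⟨m, hm, hmax⟩ := Finset.exists_max_image _ (fun m : Fin (n ^ 2) => (m : ℕ)) hne
    have hm0 : f m ≠ 0 := by simpa using hm
    obtain ⟨i, s, hi, hs, hms⟩ := exists_block n m.2
    have hm' : m = ⟨n * i + s, block_index_lt n hi hs⟩ := Fin.ext hms
    set g := Function.update f m (f m - 1) with hg
    have hgf : Function.update g m (g m + 1) = f := by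
      rw [hg, Function.update_idem, Function.update_self, Nat.sub_add_cancel (by omega),
        Function.update_eq_self]
    have hgk : ∑ l, g l = k := by
      have h2 := Finset.sum_update_of_mem (Finset.mem_univ m) f (f m - 1)
      have h3 := Finset.add_sum_erase Finset.univ f (Finset.mem_univ m)
      rw [← Finset.erase_eq] at h2
      rw [hg, h2]
      omega
    have hgz : ∀ l : Fin (n ^ 2), n * (i + 1) ≤ l → g l = 0 := by
      intro l hl
      rw [Nat.mul_succ] at hl
      have hlm : l ≠ m := by rintro rfl; omega
      rw [hg, Function.update_of_ne hlm]
      by_contra hl0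
      have := hmax l (by simpa using hl0)
      omega
    obtain ⟨c, hc, j, h2⟩ := fockOp_create n q h0 h1 hi hs hgz
    rw [← hm', hgf] at h2
    have h3 := V.smul_mem c⁻¹ (h ⟨i, hi⟩ j _ (ih g hgk))
    rwa [h2, smul_smul, inv_mul_cancel₀ hc, one_smul] at h3

end

/-! ### Normal ordering in `Pol(Mat_n)_q` -/

section
variable (n : ℕ) (q : ℝ)

theorem Pol.star_zs {n : ℕ} {q : ℝ} (α a : Fin n) :
    star (Pol.zs α a : Pol n q) = Pol.z α a := by
  rw [← Pol.star_z, star_star]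

theorem Pol.zs_mul_z {n : ℕ} {q : ℝ} (α β a b : Fin n) :
    (Pol.zs β b * Pol.z α a : Pol n q) =
      (q : ℂ) ^ 2 • (∑ a' : Fin n, ∑ b' : Fin n, ∑ α' : Fin n, ∑ β' : Fin n,
        (Rcoef q b a b' a' * Rcoef q β α β' α') • (Pol.z α' a' * Pol.zs β' b'))
          + if a = b ∧ α = β then algebraMap ℂ (Pol n q) (1 - (q : ℂ) ^ 2) else 0 := by
  have h := Pol.rel (PolRel.sz (q := q) α β a b)
  rw [apply_ite (fun x => _ + x), apply_ite (Pol.mk n q)] at h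
  simp only [map_mul, map_add, map_smul, map_sum, AlgHom.commutes, map_zero] at h
  rw [apply_ite (fun x => _ + x)]
  exact h

/-- The monomials in the generators `z_a^α`. -/
def holWords : Submonoid (Pol n q) :=
  Submonoid.closure (Set.range fun p : Fin n × Fin n => Pol.z p.1 p.2)

/-- The monomials in the generators `(z_a^α)^*`. -/
def antiholWords : Submonoid (Pol n q) :=
  Submonoid.closure (Set.range fun p : Fin n × Fin n => Pol.zs p.1 p.2)

/-- The span of the normally ordered monomials. -/
def normalOrdered : Submodule ℂ (Pol n q) :=
  Submodule.span ℂ (Set.image2 (· * ·) (holWords n q : Set (Pol n q)) (antiholWords n q))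

variable {n q}

theorem z_mem_holWords (α a : Fin n) : (Pol.z α a : Pol n q) ∈ holWords n q :=
  Submonoid.subset_closure ⟨(α, a), rfl⟩

theorem zs_mem_antiholWords (α a : Fin n) : (Pol.zs α a : Pol n q) ∈ antiholWords n q :=
  Submonoid.subset_closure ⟨(α, a), rfl⟩

theorem mul_mem_normalOrdered {x y : Pol n q} (hx : x ∈ holWords n q) (hy : y ∈ antiholWords n q) :
    x * y ∈ normalOrdered n q :=
  Submodule.subset_span ⟨x, hx, y, hy, rfl⟩

theorem holWord_mul_mem {x y : Pol n q} (hx : x ∈ holWords n q) (hy : y ∈ normalOrdered n q) :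
    x * y ∈ normalOrdered n q := by
  induction hy using Submodule.span_induction with
  | mem y hy =>
    obtain ⟨w, hw, w', hw', rfl⟩ := hy
    simp only [← mul_assoc]
    exact mul_mem_normalOrdered (mul_mem hx hw) hw'
  | zero => rw [mul_zero]; exact zero_mem _
  | add y y' _ _ h h' => rw [mul_add]; exact add_mem h h'
  | smul c y _ h => rw [mul_smul_comm]; exact Submodule.smul_mem _ c h

theorem mul_antiholWord_mem {x y : Pol n q} (hx : x ∈ normalOrdered n q)
    (hy : y ∈ antiholWords n q) : x * y ∈ normalOrdered n q := by
  induction hx using Submodule.span_induction with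
  | mem x hx =>
    obtain ⟨w, hw, w', hw', rfl⟩ := hx
    simp only [mul_assoc]
    exact mul_mem_normalOrdered hw (mul_mem hw' hy)
  | zero => rw [zero_mul]; exact zero_mem _
  | add y y' _ _ h h' => rw [add_mul]; exact add_mem h h'
  | smul c y _ h => rw [smul_mul_assoc]; exact Submodule.smul_mem _ c h

/-- Induction on the length of `w`. The indices `β`, `b` must vary, because moving an adjoint past
one generator produces other adjoints. -/
theorem zs_mul_holWord_mem {w : Pol n q} (hw : w ∈ holWords n q) (β b : Fin n) :
    Pol.zs β b * w ∈ normalOrdered n q := by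
  induction hw using Submonoid.closure_induction_left generalizing β b with
  | one =>
    rw [mul_one, ← one_mul (Pol.zs β b)]
    exact mul_mem_normalOrdered (one_mem _) (zs_mem_antiholWords β b)
  | mul_left x hx w hw ih =>
    obtain ⟨⟨α, a⟩, rfl⟩ := hx
    simp only [← mul_assoc, Pol.zs_mul_z, add_mul, smul_mul_assoc, Finset.sum_mul]
    refine add_mem (Submodule.smul_mem _ _ (sum_mem fun a' _ => sum_mem fun b' _ =>
      sum_mem fun α' _ => sum_mem fun β' _ => Submodule.smul_mem _ _ ?_)) ?_
    · rw [mul_assoc]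
      exact holWord_mul_mem (z_mem_holWords α' a') (ih β' b')
    · split_ifs
      · rw [← Algebra.smul_def, ← mul_one w]
        exact Submodule.smul_mem _ _ (mul_mem_normalOrdered hw (one_mem _))
      · rw [zero_mul]; exact zero_mem _

theorem zs_mul_mem {x : Pol n q} (hx : x ∈ normalOrdered n q) (β b : Fin n) :
    Pol.zs β b * x ∈ normalOrdered n q := by
  induction hx using Submodule.span_induction with
  | mem x hx =>
    obtain ⟨w, hw, w', hw', rfl⟩ := hx
    simp only [← mul_assoc]
    exact mul_antiholWord_mem (zs_mul_holWord_mem hw β b) hw'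
  | zero => rw [mul_zero]; exact zero_mem _
  | add y y' _ _ h h' => rw [mul_add]; exact add_mem h h'
  | smul c y _ h => rw [mul_smul_comm]; exact Submodule.smul_mem _ c h

theorem mem_normalOrdered (x : Pol n q) : x ∈ normalOrdered n q := by
  -- The normally ordered span is stable under left multiplication by everything; applied to 1 this
  -- gives the claim.
  have key : ∀ (x : Free n) (y : Pol n q), y ∈ normalOrdered n q →
      Pol.mk n q x * y ∈ normalOrdered n q := by
    intro x
    induction x using FreeAlgebra.induction with
    | grade0 r =>
      intro y hy
      rw [AlgHom.commutes, ← Algebra.smul_def]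
      exact Submodule.smul_mem _ r hy
    | grade1 p =>
      intro y hy
      rcases p with ⟨α, a⟩ | ⟨α, a⟩
      · exact holWord_mul_mem (z_mem_holWords α a) hy
      · exact zs_mul_mem hy α a
    | mul x x' hx hx' =>
      intro y hy
      rw [map_mul, mul_assoc]
      exact hx _ (hx' y hy)
    | add x x' hx hx' =>
      intro y hy
      rw [map_add, add_mul]
      exact add_mem (hx y hy) (hx' y hy)
  obtain ⟨x, rfl⟩ := Pol.mk_surjective n q x
  have h1 : (1 : Pol n q) ∈ normalOrdered n q := by
    rw [← mul_one (1 : Pol n q)]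
    exact mul_mem_normalOrdered (one_mem _) (one_mem _)
  simpa using key x 1 h1

/-- A functional on `Pol(Mat_n)_q` that vanishes on the products `z x` and `x z^*` is determined by
its value at `1`. -/
theorem functional_eq_zero (φ : Pol n q →ₗ[ℂ] ℂ) (h1 : φ 1 = 0)
    (hz : ∀ α a x, φ (Pol.z α a * x) = 0) (hzs : ∀ α a x, φ (x * Pol.zs α a) = 0) : φ = 0 := by
  ext x
  have hx := mem_normalOrdered x
  rw [LinearMap.zero_apply]
  induction hx using Submodule.span_induction with
  | mem x hx =>
    obtain ⟨w, hw, w', hw', rfl⟩ := hx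
    induction hw using Submonoid.closure_induction_left with
    | one =>
      induction hw' using Submonoid.closure_induction_right with
      | one => simpa using h1
      | mul_right w' _ y hy _ =>
        obtain ⟨⟨α, a⟩, rfl⟩ := hy
        simpa using hzs α a w'
    | mul_left y hy w _ _ =>
      obtain ⟨⟨α, a⟩, rfl⟩ := hy
      simpa [mul_assoc] using hz α a (w * w')
  | zero => exact map_zero φ
  | add y y' _ _ h h' => rw [map_add, h, h', add_zero]
  | smul c y _ h => rw [map_smul, h, smul_zero]

end

/-! ### Uniqueness of the Fock representation -/

namespace FockRep

variable {n : ℕ} {q : ℝ} {H : Type*} [NormedAddCommGroup H] [InnerProductSpace ℂ H]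
  [CompleteSpace H] (F : FockRep n q H)

theorem rep_vacuum (f : Pol n q) :
    F.rep f (F.emb (vacuum n q)) = F.emb (Submodule.Quotient.mk f) := by
  rw [← F.emb_smul, vacuum, ← Submodule.Quotient.mk_smul, smul_eq_mul, mul_one]

theorem rep_zs_vacuum (α a : Fin n) : F.rep (Pol.zs α a) (F.emb (vacuum n q)) = 0 := by
  have : (Submodule.Quotient.mk (Pol.zs α a : Pol n q) : FockModule n q) = 0 := by
    rw [Submodule.Quotient.mk_eq_zero]
    exact Submodule.subset_span ⟨(α, a), Pol.star_z α a⟩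
  rw [rep_vacuum, this, map_zero]

/-- The vacuum expectation `f ↦ (v₀, f v₀)`. -/
def expectation : Pol n q →ₗ[ℂ] ℂ where
  toFun f := inner ℂ (F.emb (vacuum n q)) (F.rep f (F.emb (vacuum n q)))
  map_add' f g := by rw [map_add, add_apply, inner_add_right]
  map_smul' c f := by rw [map_smul, smul_apply, inner_smul_right]; rfl

theorem expectation_apply (f : Pol n q) : F.expectation f =
    inner ℂ (F.emb (vacuum n q)) (F.rep f (F.emb (vacuum n q))) := rfl

theorem inner_rep_left (f : Pol n q) (x y : H) :
    inner ℂ (F.rep f x) y = inner ℂ x (F.rep (star f) y) := by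
  rw [map_star, ContinuousLinearMap.star_eq_adjoint, ContinuousLinearMap.adjoint_inner_right]

theorem expectation_one : F.expectation 1 = 1 := by
  rw [expectation_apply, map_one, one_apply_eq_self, inner_self_eq_norm_sq_to_K, F.norm_emb_vacuum]
  simp

theorem expectation_mul_zs (α a : Fin n) (x : Pol n q) : F.expectation (x * Pol.zs α a) = 0 := by
  rw [expectation_apply, map_mul]
  change inner ℂ _ (F.rep x (F.rep (Pol.zs α a) _)) = _
  rw [rep_zs_vacuum, map_zero, inner_zero_right]

theorem expectation_z_mul (α a : Fin n) (x : Pol n q) : F.expectation (Pol.z α a * x) = 0 := by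
  rw [expectation_apply, map_mul]
  change inner ℂ _ (F.rep (Pol.z α a) (F.rep x _)) = _
  rw [← Pol.star_zs, ← inner_rep_left, rep_zs_vacuum, inner_zero_left]

/-- The form on the Fock module is thus determined by the vacuum expectation. -/
theorem inner_emb (f g : Pol n q) : inner ℂ (F.emb (Submodule.Quotient.mk f))
    (F.emb (Submodule.Quotient.mk g)) = F.expectation (star f * g) := by
  rw [expectation_apply, map_mul]
  change _ = inner ℂ _ (F.rep (star f) (F.rep g _))
  rw [← inner_rep_left, rep_vacuum, rep_vacuum]

variable {H' : Type*} [NormedAddCommGroup H'] [InnerProductSpace ℂ H'] [CompleteSpace H']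
  (F' : FockRep n q H')

/-- Both functionals vanish on z x and x z^* and equal 1 at 1, so normal ordering forces their
difference to be zero. -/
theorem expectation_eq : F.expectation = F'.expectation := by
  rw [← sub_eq_zero]
  refine functional_eq_zero _ ?_ (fun α a x => ?_) fun α a x => ?_
  · rw [LinearMap.sub_apply, expectation_one, expectation_one, sub_self]
  · rw [LinearMap.sub_apply, expectation_z_mul, expectation_z_mul, sub_self]
  · rw [LinearMap.sub_apply, expectation_mul_zs, expectation_mul_zs, sub_self]

theorem norm_emb_eq (u : FockModule n q) : ‖F'.emb u‖ = ‖F.emb u‖ := by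
  obtain ⟨f, rfl⟩ := Submodule.Quotient.mk_surjective _ u
  rw [@norm_eq_sqrt_re_inner ℂ, @norm_eq_sqrt_re_inner ℂ, inner_emb, inner_emb, expectation_eq F F']

/-- The canonical unitary between two realizations of the Fock representation. -/
def unitaryEquiv : H ≃ₗᵢ[ℂ] H' :=
  (LinearEquiv.refl ℂ (FockModule n q)).extendOfIsometry F.emb F'.emb F.denseRange_emb
    F'.denseRange_emb (norm_emb_eq F F')

theorem unitaryEquiv_emb (u : FockModule n q) : unitaryEquiv F F' (F.emb u) = F'.emb u :=
  LinearEquiv.extendOfIsometry_eq (LinearEquiv.refl ℂ (FockModule n q)) F.emb F'.emb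
    F.denseRange_emb F'.denseRange_emb (norm_emb_eq F F') u

theorem unitaryEquiv_conj (f : Pol n q) :
    (unitaryEquiv F F').conjStarAlgEquiv (F.rep f) = F'.rep f := by
  refine DFunLike.coe_injective (F'.denseRange_emb.equalizer (ContinuousLinearMap.continuous _)
    (ContinuousLinearMap.continuous _) (funext fun u => ?_))
  rw [Function.comp_apply, Function.comp_apply, LinearIsometryEquiv.conjStarAlgEquiv_apply_apply, ← unitaryEquiv_emb F F' u,
    LinearIsometryEquiv.symm_apply_apply, ← F.emb_smul, unitaryEquiv_emb, unitaryEquiv_emb,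
    F'.emb_smul]

end FockRep

/-! ### The Fock representation on `ℓ²(ℕ)^{⊗ n²}` -/

section
variable (n : ℕ) (q : ℝ) (h0 : 0 < q) (h1 : q < 1)

/-- The scaling factor `q^{r+1-n}`. -/
def fockScale (r : ℕ) : ℂ := (q : ℂ) ^ ((r + 1 : ℤ) - (n : ℤ))

/-- The matrix of the operators `π_u(t_{a,b})`. -/
abbrev fockMat : Matrix (Fin (2 * n)) (Fin (2 * n))
    (L2 (Fin (n ^ 2) → ℕ) →L[ℂ] L2 (Fin (n ^ 2) → ℕ)) :=
  wordMat q h0 h1 (fockWord n) (2 * n) (List.finRange (n ^ 2))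

theorem fockOp_eq_smul (i j : Fin n) : fockOp n q h0 h1 i j =
    fockScale n q i • fockMat n q h0 h1 (lowerRight n i) (lowerRight n j) :=
  fockOp_eq_wordMat n q h0 h1 i j

theorem isRTT_fockMat : IsRTT (q : ℂ) (fockMat n q h0 h1) :=
  isRTT_wordMat q h0 h1 (fockWord n) (2 * n) (List.nodup_finRange _)

theorem lowerRight_strictMono : StrictMono (lowerRight n) := fun _ _ h =>
  Nat.add_lt_add_left h n

theorem exists_lowerRight {x : Fin n} {j : Fin (2 * n)} (h : lowerRight n x < j) :
    ∃ y, lowerRight n y = j := by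
  have h' : n + (x : ℕ) < j := h
  exact ⟨⟨j - n, by omega⟩, Fin.ext (by simp only [lowerRight]; omega)⟩

/-! ### The defining relations for the concrete operators. -/

theorem fockOp_zz_q (α β a b : Fin n) (h : (a = b ∧ α < β) ∨ (a < b ∧ α = β)) :
    fockOp n q h0 h1 α a * fockOp n q h0 h1 β b =
      (q : ℂ) • (fockOp n q h0 h1 β b * fockOp n q h0 h1 α a) := by
  have key : fockMat n q h0 h1 (lowerRight n α) (lowerRight n a) *
      fockMat n q h0 h1 (lowerRight n β) (lowerRight n b) = (q : ℂ) •
      (fockMat n q h0 h1 (lowerRight n β) (lowerRight n b) *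
        fockMat n q h0 h1 (lowerRight n α) (lowerRight n a)) := by
    rcases h with ⟨rfl, h⟩ | ⟨h, rfl⟩
    · exact (isRTT_fockMat n q h0 h1).col (lowerRight_strictMono n h)
    · exact (isRTT_fockMat n q h0 h1).row (lowerRight_strictMono n h)
  simp only [fockOp_eq_smul, smul_mul_assoc, mul_smul_comm, key]
  module

theorem fockOp_zz_comm (α β a b : Fin n) (h : α < β ∧ b < a) :
    fockOp n q h0 h1 α a * fockOp n q h0 h1 β b =
      fockOp n q h0 h1 β b * fockOp n q h0 h1 α a := by
  have key := (isRTT_fockMat n q h0 h1).comm (lowerRight_strictMono n h.1)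
    (lowerRight_strictMono n h.2)
  simp only [fockOp_eq_smul, smul_mul_assoc, mul_smul_comm, key]
  module

theorem fockOp_zz_cross (α β a b : Fin n) (h : α < β ∧ a < b) :
    fockOp n q h0 h1 α a * fockOp n q h0 h1 β b =
      fockOp n q h0 h1 β b * fockOp n q h0 h1 α a +
        ((q : ℂ) - (q : ℂ)⁻¹) • (fockOp n q h0 h1 β a * fockOp n q h0 h1 α b) := by
  have key := (isRTT_fockMat n q h0 h1).cross (lowerRight_strictMono n h.1)
    (lowerRight_strictMono n h.2)
  simp only [fockOp_eq_smul, smul_mul_assoc, mul_smul_comm, key]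
  module

theorem fockOp_sz (α β a b : Fin n) :
    star (fockOp n q h0 h1 β b) * fockOp n q h0 h1 α a =
      (q : ℂ) ^ 2 • (∑ a' : Fin n, ∑ b' : Fin n, ∑ α' : Fin n, ∑ β' : Fin n,
        (Rcoef q b a b' a' * Rcoef q β α β' α') •
          (fockOp n q h0 h1 α' a' * star (fockOp n q h0 h1 β' b'))) +
        if a = b ∧ α = β then algebraMap ℂ (L2 (Fin (n ^ 2) → ℕ) →L[ℂ] L2 (Fin (n ^ 2) → ℕ))
          (1 - (q : ℂ) ^ 2) else 0 := by
  have hq : (q : ℂ) ≠ 0 := by exact_mod_cast h0.ne'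
  refine (isRTT_fockMat n q h0 h1).block_relation hq
    (isUnitaryMatrix_wordMat q h0 h1 (fockWord n) (fockWord_bounds n) _) (lowerRight_strictMono n)
    (fun x j h => exists_lowerRight n h) (p := fockScale n q) ?_ (fun r => ?_) (fun r => ?_)
    (fockOp_eq_smul n q h0 h1) α β a b
  · simp [fockScale]
  · rw [fockScale, fockScale, ← zpow_one_add₀ hq]
    congr 1
    push_cast
    ring
  · simp [fockScale]

/-- The values of the Fock representation on the free algebra. -/
def freeFockRep : Free n →ₐ[ℂ] (L2 (Fin (n ^ 2) → ℕ) →L[ℂ] L2 (Fin (n ^ 2) → ℕ)) :=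
  FreeAlgebra.lift ℂ (Sum.elim (fun p => fockOp n q h0 h1 p.1 p.2)
    (fun p => star (fockOp n q h0 h1 p.1 p.2)))

theorem freeFockRep_fz (α a : Fin n) :
    freeFockRep n q h0 h1 (fz α a) = fockOp n q h0 h1 α a := by simp [freeFockRep, fz]

theorem freeFockRep_fzs (α a : Fin n) :
    freeFockRep n q h0 h1 (fzs α a) = star (fockOp n q h0 h1 α a) := by simp [freeFockRep, fzs]

theorem freeFockRep_rel ⦃x y : Free n⦄ (h : PolRel n q x y) :
    freeFockRep n q h0 h1 x = freeFockRep n q h0 h1 y := by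
  have hq : star (q : ℂ) = q := Complex.conj_ofReal q
  induction h with
  | zz_q α β a b h =>
    simpa only [map_mul, map_smul, freeFockRep_fz] using fockOp_zz_q n q h0 h1 α β a b h
  | zz_comm α β a b h =>
    simpa only [map_mul, freeFockRep_fz] using fockOp_zz_comm n q h0 h1 α β a b h
  | zz_cross α β a b h =>
    simpa only [map_mul, map_add, map_smul, freeFockRep_fz] using
      fockOp_zz_cross n q h0 h1 α β a b h
  | ss_q α β a b h =>
    simpa only [map_mul, map_smul, freeFockRep_fzs, star_mul, star_smul, hq] using
      congrArg star (fockOp_zz_q n q h0 h1 α β a b h)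
  | ss_comm α β a b h =>
    simpa only [map_mul, freeFockRep_fzs, star_mul] using
      congrArg star (fockOp_zz_comm n q h0 h1 α β a b h)
  | ss_cross α β a b h =>
    simpa only [map_mul, map_add, map_smul, freeFockRep_fzs, star_mul, star_add, star_smul, star_sub,
      star_inv₀, hq] using congrArg star (fockOp_zz_cross n q h0 h1 α β a b h)
  | sz α β a b =>
    simpa only [map_mul, map_add, map_smul, map_sum, freeFockRep_fz, freeFockRep_fzs,
      apply_ite (freeFockRep n q h0 h1), AlgHom.commutes, map_zero] using fockOp_sz n q h0 h1 α β a b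

/-- The Fock representation as an algebra homomorphism. -/
def polFockHom : Pol n q →ₐ[ℂ] (L2 (Fin (n ^ 2) → ℕ) →L[ℂ] L2 (Fin (n ^ 2) → ℕ)) :=
  RingQuot.liftAlgHom ℂ ⟨freeFockRep n q h0 h1, freeFockRep_rel n q h0 h1⟩

theorem polFockHom_mk (x : Free n) :
    polFockHom n q h0 h1 (Pol.mk n q x) = freeFockRep n q h0 h1 x :=
  RingQuot.liftAlgHom_mkAlgHom_apply ℂ (freeFockRep n q h0 h1) (freeFockRep_rel n q h0 h1) x

theorem polFockHom_z (α a : Fin n) :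
    polFockHom n q h0 h1 (Pol.z α a) = fockOp n q h0 h1 α a := by
  rw [Pol.z, polFockHom_mk, freeFockRep_fz]

theorem polFockHom_zs (α a : Fin n) :
    polFockHom n q h0 h1 (Pol.zs α a) = star (fockOp n q h0 h1 α a) := by
  rw [Pol.zs, polFockHom_mk, freeFockRep_fzs]

theorem polFockHom_star (x : Pol n q) :
    polFockHom n q h0 h1 (star x) = star (polFockHom n q h0 h1 x) := by
  obtain ⟨x, rfl⟩ := Pol.mk_surjective n q x
  induction x using FreeAlgebra.induction with
  | grade0 r =>
    rw [AlgHom.commutes, ← algebraMap_star_comm, AlgHom.commutes, AlgHom.commutes,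
      algebraMap_star_comm]
  | grade1 p =>
    rcases p with ⟨α, a⟩ | ⟨α, a⟩
    · change polFockHom n q h0 h1 (star (Pol.z α a)) = star (polFockHom n q h0 h1 (Pol.z α a))
      rw [Pol.star_z, polFockHom_z, polFockHom_zs]
    · change polFockHom n q h0 h1 (star (Pol.zs α a)) = star (polFockHom n q h0 h1 (Pol.zs α a))
      rw [Pol.star_zs, polFockHom_z, polFockHom_zs, star_star]
  | mul x y hx hy => rw [map_mul, star_mul, map_mul, map_mul, star_mul, hx, hy]
  | add x y hx hy => rw [map_add, star_add, map_add, map_add, star_add, hx, hy]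

/-- The Fock representation as a `*`-homomorphism. -/
def polFockRep : Pol n q →⋆ₐ[ℂ] (L2 (Fin (n ^ 2) → ℕ) →L[ℂ] L2 (Fin (n ^ 2) → ℕ)) :=
  { polFockHom n q h0 h1 with map_star' := polFockHom_star n q h0 h1 }

theorem polFockRep_apply (f : Pol n q) : polFockRep n q h0 h1 f = polFockHom n q h0 h1 f := rfl

/-- The map `f ↦ f e_0` on `Pol(Mat_n)_q`. -/
def vacuumOrbit : Pol n q →ₗ[ℂ] L2 (Fin (n ^ 2) → ℕ) where
  toFun f := polFockRep n q h0 h1 f (basisVec 0)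
  map_add' f g := by rw [map_add, add_apply]
  map_smul' c f := by rw [map_smul, smul_apply]; rfl

theorem vacuumOrbit_mul (f g : Pol n q) : vacuumOrbit n q h0 h1 (f * g) =
    polFockRep n q h0 h1 f (vacuumOrbit n q h0 h1 g) := by
  change polFockRep n q h0 h1 (f * g) _ = _
  rw [map_mul]
  rfl

theorem vacuumOrbit_eq_zero {f : Pol n q} (hf : f ∈ vacuumIdeal n q) :
    vacuumOrbit n q h0 h1 f = 0 := by
  induction hf using Submodule.span_induction with
  | mem f hf =>
    obtain ⟨⟨α, a⟩, rfl⟩ := hf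
    change polFockHom n q h0 h1 (star (Pol.z α a)) _ = 0
    rw [Pol.star_z, polFockHom_zs, star_fockOp_vacuum]
  | zero => exact map_zero _
  | add f g _ _ hf hg => rw [map_add, hf, hg, add_zero]
  | smul x f _ hf => rw [smul_eq_mul, vacuumOrbit_mul, hf, map_zero]

/-- The canonical map of the Fock module to `ℓ²(ℕ)^{⊗ n²}`. -/
def fockEmb : FockModule n q →ₗ[ℂ] L2 (Fin (n ^ 2) → ℕ) :=
  (((vacuumIdeal n q).restrictScalars ℂ).liftQ (vacuumOrbit n q h0 h1)
    fun _ hf => vacuumOrbit_eq_zero n q h0 h1 hf) ∘ₗ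
      (Submodule.Quotient.restrictScalarsEquiv ℂ (vacuumIdeal n q)).symm.toLinearMap

theorem fockEmb_mk (f : Pol n q) :
    fockEmb n q h0 h1 (Submodule.Quotient.mk f) = vacuumOrbit n q h0 h1 f := rfl

theorem denseRange_fockEmb : DenseRange (fockEmb n q h0 h1) := by
  -- The orbit of the vacuum is a subspace invariant under all 𝒯(z_j^i), so it contains every basis
  -- vector.
  have hmem : ∀ f, basisVec f ∈ LinearMap.range (vacuumOrbit n q h0 h1) := by
    refine basisVec_mem n q h0 h1 _ ⟨1, ?_⟩ ?_
    · change polFockRep n q h0 h1 1 _ = _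
      rw [map_one]
      rfl
    · rintro i j _ ⟨f, rfl⟩
      exact ⟨Pol.z i j * f, by rw [vacuumOrbit_mul, polFockRep_apply, polFockHom_z]⟩
  intro x
  have hx := lp.hasSum_single (E := fun _ : Fin (n ^ 2) → ℕ => ℂ) (p := 2) ENNReal.ofNat_ne_top x
  refine mem_closure_of_tendsto hx (Filter.Eventually.of_forall fun s => ?_)
  have : ∑ f ∈ s, lp.single (E := fun _ : Fin (n ^ 2) → ℕ => ℂ) 2 f (x f) ∈
      LinearMap.range (vacuumOrbit n q h0 h1) := by
    refine sum_mem fun f _ => ?_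
    have h := Submodule.smul_mem _ (x f) (hmem f)
    rwa [basisVec, ← lp.single_smul, smul_eq_mul, mul_one] at h
  obtain ⟨f, hf⟩ := this
  exact ⟨Submodule.Quotient.mk f, by rw [fockEmb_mk, hf]⟩

/-- The Fock representation on `ℓ²(ℕ)^{⊗ n²}`. -/
def concreteFockRep : FockRep n q (L2 (Fin (n ^ 2) → ℕ)) where
  rep := polFockRep n q h0 h1
  emb := fockEmb n q h0 h1
  emb_smul f u := by
    obtain ⟨g, rfl⟩ := Submodule.Quotient.mk_surjective _ u
    rw [← Submodule.Quotient.mk_smul, smul_eq_mul, fockEmb_mk, fockEmb_mk, vacuumOrbit_mul]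
  norm_emb_vacuum := by
    change ‖polFockRep n q h0 h1 1 (basisVec 0)‖ = 1
    rw [map_one, one_apply_eq_self, lp.norm_single (by norm_num), norm_one]
  denseRange_emb := denseRange_fockEmb n q h0 h1

theorem concreteFockRep_z (i j : Fin n) :
    (concreteFockRep n q h0 h1).rep (Pol.z i j) = fockOp n q h0 h1 i j :=
  polFockHom_z n q h0 h1 i j

end

/-! ### Transfer of the generated C*-algebra along a unitary, and the conclusion. -/

theorem conj_mem_of_mem_fockCStar {n : ℕ} {q : ℝ} {H H' : Type*} [NormedAddCommGroup H]
    [InnerProductSpace ℂ H] [CompleteSpace H] [NormedAddCommGroup H'] [InnerProductSpace ℂ H']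
    [CompleteSpace H'] (F : FockRep n q H) (U : H ≃ₗᵢ[ℂ] H') {B : StarSubalgebra ℂ (H' →L[ℂ] H')}
    (hB : IsClosed (B : Set (H' →L[ℂ] H')))
    (h : ∀ i j, U.conjStarAlgEquiv (F.rep (Pol.z i j)) ∈ B) {x : H →L[ℂ] H}
    (hx : x ∈ fockCStar F) : U.conjStarAlgEquiv x ∈ B := by
  let φ : (H →L[ℂ] H) →⋆ₐ[ℂ] (H' →L[ℂ] H') :=
    U.conjStarAlgEquiv.toStarAlgHom
  have hφ : Continuous φ :=
    U.toContinuousLinearEquiv.conjContinuousAlgEquiv.continuous_toFun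
  -- The preimage of `B` under conjugation is a closed *-subalgebra containing the generators.
  have hle : fockCStar F ≤ B.comap φ := by
    refine StarSubalgebra.topologicalClosure_minimal (StarAlgebra.adjoin_le ?_) (hB.preimage hφ)
    rintro _ ⟨⟨i, j⟩, rfl⟩
    exact h i j
  exact hle hx

end QMatBall

end

theorem mainTheorem5 (n : ℕ) (q : ℝ) (hq0 : 0 < q) (hq1 : q < 1) :
    (∃ F : QMatBall.FockRep n q (QMatBall.L2 (Fin (n ^ 2) → ℕ)),
      ∀ i j : Fin n, F.rep (QMatBall.Pol.z i j) = QMatBall.fockOp n q hq0 hq1 i j) ∧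
    ∀ (H : Type*) [NormedAddCommGroup H] [InnerProductSpace ℂ H] [CompleteSpace H]
      (F : QMatBall.FockRep n q H),
      ∃ U : H ≃ₗᵢ[ℂ] QMatBall.L2 (Fin (n ^ 2) → ℕ),
        (∀ i j : Fin n, U.conjStarAlgEquiv (F.rep (QMatBall.Pol.z i j)) =
          QMatBall.fockOp n q hq0 hq1 i j) ∧
        ∀ x ∈ QMatBall.fockCStar F, U.conjStarAlgEquiv x ∈ QMatBall.toeplitzTensor (n ^ 2) := by
  refine ⟨⟨_, QMatBall.concreteFockRep_z n q hq0 hq1⟩, fun H _ _ _ F => ?_⟩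
  have hU : ∀ i j : Fin n, (F.unitaryEquiv (QMatBall.concreteFockRep n q hq0 hq1)).conjStarAlgEquiv
      (F.rep (QMatBall.Pol.z i j)) = QMatBall.fockOp n q hq0 hq1 i j := fun i j => by
    rw [QMatBall.FockRep.unitaryEquiv_conj, QMatBall.concreteFockRep_z]
  refine ⟨_, hU, fun x hx => QMatBall.conj_mem_of_mem_fockCStar F _
    (B := QMatBall.toeplitzTensor (n ^ 2)) (StarSubalgebra.isClosed_topologicalClosure _)
    (fun i j => ?_) hx⟩
  rw [hU]
  exact QMatBall.fockOp_mem_toeplitzTensor n q hq0 hq1 i j
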